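/- **Setting.** A simultaneous multicast instance consists of an undirected simple graph $G$ on $n$ nodes and a finite family of rooted trees $(T_i)$ in $G$, each with its own identifier $i$. Its congestion $C$ is the maximum over the edges $e$ of $G$ of the number of trees containing $e$, and its dilation $D$ is the maximum depth of a tree. A path decomposition of a rooted tree is a set of descending paths, each with at least one edge, such that every edge of the tree lies on exactly one of them; for reals $\ell,k$ it is $(\ell,k)$-short if every root-to-leaf path shares an edge with at most $d/\ell+k$ of its paths, where $d$ is the depth of the tree. In the CONGEST model with shared randomness all nodes run the same algorithm in synchronous rounds; in each round each node can send a message of at most $\beta\lfloor\log_2 n\rfloor$ bits along each incident edge, where $\beta\ge 1$ is a fixed integer. Initially a node knows $n$, $C$, $D$, its own identifier (nodes have arbitrary distinct identifiers), an arbitrary numbering of its incident edges, the identifiers of the trees to which it belongs, of which of these it is the root, and which of its incident edges belong to which trees; all nodes also see one common infinite sequence of independent fair random bits. The algorithm computes a path decomposition of each tree if in the end both endpoints of each edge of each tree $T_i$ know which of them is the parent in $T_i$, and whether the edge is the topmost edge of its path in the decomposition of $T_i$ (this determines the paths). **Lemma.** For every real $\varepsilon\ge 0$, all integers $b,c\ge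 0$ and every bandwidth constant $\beta\ge1$ there are a constant $A$ and a CONGEST algorithm with shared randomness such that for every simultaneous multicast instance with $n\ge 3$ and $C\le n^b$ (as is the case when the tree identifiers have $b\log_2 n$ bits), with probability at least $1-n^{-c}$, the algorithm computes a $(\log_2^{1+\varepsilon} n,\ \log_2 n)$-short path decomposition of every tree $T_i$. The algorithm always stops after at most $$A\,(C+D)\left(1+\frac{\log_2\min\{C,D\}}{\log_2\log_2 n}\right)$$ rounds (no rounds if $C=D=0$). -/

import Mathlib

namespace Multicast

/-- A point-to-point network: an undirected simple graph, an arbitrary assignment of unique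
identifiers to the nodes, and at every node `v` an arbitrary numbering `0, …, deg v - 1` of the
incident edges by ports (so that initially a node does not know who its neighbours are). -/
structure Network (V : Type) where
  graph : SimpleGraph V
  nodeId : V → ℕ
  nodeId_injective : Function.Injective nodeId
  deg : V → ℕ
  port : ∀ v, Fin (deg v) ≃ graph.neighborSet v

/-- The neighbour of `v` at the other end of its port `p`. -/
def Network.nbr {V : Type} (N : Network V) (v : V) (p : Fin (N.deg v)) : V := (N.port v p).1

theorem Network.adj_nbr {V : Type} (N : Network V) (v : V) (p : Fin (N.deg v)) :
    N.graph.Adj v (N.nbr v p) := (N.port v p).2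

/-- The port of the neighbour `N.nbr v p` that leads back to `v`. -/
def Network.backPort {V : Type} (N : Network V) (v : V) (p : Fin (N.deg v)) :
    Fin (N.deg (N.nbr v p)) :=
  (N.port (N.nbr v p)).symm ⟨v, (N.adj_nbr v p).symm⟩

/-- A rooted tree in the graph `G`. -/
structure RootedTree {V : Type} (G : SimpleGraph V) where
  toSubgraph : G.Subgraph
  isTree : toSubgraph.coe.IsTree
  root : V
  root_mem : root ∈ toSubgraph.verts

namespace RootedTree

variable {V : Type} {G : SimpleGraph V}

/-- The distance in the tree from the root to `v` (with value `0` if `v` is not in the tree). -/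
noncomputable def level (T : RootedTree G) (v : V) : ℕ := T.toSubgraph.spanningCoe.dist T.root v

/-- The depth of the tree. -/
noncomputable def depth [Fintype V] (T : RootedTree G) : ℕ := Finset.univ.sup T.level

/-- `T.IsChild u v`: there is a tree edge from `u` down to `v`, i.e. `v` is a child of `u`. -/
def IsChild (T : RootedTree G) (u v : V) : Prop :=
  T.toSubgraph.Adj u v ∧ T.level v = T.level u + 1

def IsLeaf (T : RootedTree G) (v : V) : Prop :=
  v ∈ T.toSubgraph.verts ∧ ∀ w, ¬ T.IsChild v w

/-- `q` lists, from top to bottom, the vertices of a root-to-leaf path. -/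
def IsRootToLeafPath (T : RootedTree G) (q : List V) : Prop :=
  q.IsChain T.IsChild ∧ q.head? = some T.root ∧ ∃ v, q.getLast? = some v ∧ T.IsLeaf v

/-- `P` is a path decomposition of the rooted tree: a finite set of descending paths, each with
at least one edge and listed from top to bottom, such that every edge of the tree belongs to
exactly one of them. (`[u, v] <:+: p` says that `u, v` are consecutive in the list `p`.) -/
def IsPathDecomposition (T : RootedTree G) (P : Finset (List V)) : Prop :=
  (∀ p ∈ P, 2 ≤ p.length ∧ p.IsChain T.IsChild) ∧
  ∀ u v, T.IsChild u v → ∃! p, p ∈ P ∧ [u, v] <:+: p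

open Classical in
/-- `(ℓ, k)`-shortness: each root-to-leaf path intersects (shares an edge with) at most
`depth / ℓ + k` paths of `P`. -/
def IsShort [Fintype V] (T : RootedTree G) (P : Finset (List V)) (l k : ℝ) : Prop :=
  ∀ q, T.IsRootToLeafPath q →
    ((P.filter fun p => ∃ u v, [u, v] <:+: p ∧ [u, v] <:+: q).card : ℝ) ≤ (T.depth : ℝ) / l + k

end RootedTree

/-- A simultaneous multicast instance: a network and a finite family of rooted trees in it, indexed
by their unique identifiers. -/
structure Instance (V : Type) where
  net : Network V
  ids : Finset ℕ
  tree : ℕ → RootedTree net.graph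

namespace Instance

variable {V : Type} [Fintype V]

open Classical in
/-- The maximum, over all edges, of the number of trees that contain the edge. -/
noncomputable def congestion (I : Instance V) : ℕ :=
  (Finset.univ : Finset (Sym2 V)).sup fun e =>
    (I.ids.filter fun i => e ∈ (I.tree i).toSubgraph.edgeSet).card

/-- The maximum depth of a tree. -/
noncomputable def dilation (I : Instance V) : ℕ := I.ids.sup fun i => (I.tree i).depth

end Instance

/-- What a node knows initially: the parameters `n`, `C`, `D`, its own identifier, its number of
ports, the identifiers of the trees to which it belongs and of those of which it is the root, and,
for each tree, which of its ports carry edges of that tree. It does not know which of them leads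
towards the root. -/
structure LocalInput where
  n : ℕ
  C : ℕ
  D : ℕ
  nodeId : ℕ
  deg : ℕ
  trees : Finset ℕ
  rootOf : Finset ℕ
  treePorts : ℕ → Finset ℕ

open Classical in
noncomputable def Instance.localInput {V : Type} [Fintype V] (I : Instance V) (v : V) :
    LocalInput where
  n := Fintype.card V
  C := I.congestion
  D := I.dilation
  nodeId := I.net.nodeId v
  deg := I.net.deg v
  trees := I.ids.filter fun i => v ∈ (I.tree i).toSubgraph.verts
  rootOf := I.ids.filter fun i => (I.tree i).root = v
  treePorts i := (Finset.range (I.net.deg v)).filter fun p =>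
    i ∈ I.ids ∧ ∃ h : p < I.net.deg v, (I.tree i).toSubgraph.Adj v (I.net.nbr v ⟨p, h⟩)

/-- What a node outputs about an incident edge of a tree: whether the edge leads to its parent in
the tree, and whether the edge is the first (topmost) edge of its path in the decomposition. -/
structure EdgeLabel where
  toParent : Bool
  first : Bool

/-- A synchronous message-passing algorithm, with the same code at every node. The initial state
depends on the local input and on the shared random bits; in every round a node sends a bit string
through each of its ports and updates its state from the strings received through its ports. After
`rounds n C D` rounds it outputs a label for every tree identifier and port. -/
structure Algorithm where
  State : Type
  rounds : ℕ → ℕ → ℕ → ℕ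
  init : LocalInput → (ℕ → Bool) → State
  send : State → ℕ → List Bool
  receive : State → (ℕ → List Bool) → State
  output : State → ℕ → ℕ → EdgeLabel

namespace Algorithm

variable {V : Type} [Fintype V]

/-- The states of all nodes after `t` rounds. With bandwidth `B`, only the first `B` bits of a
string sent through a port are delivered. -/
noncomputable def run (alg : Algorithm) (B : ℕ) (I : Instance V) (ω : ℕ → Bool) :
    ℕ → V → alg.State
  | 0 => fun v => alg.init (I.localInput v) ω
  | t + 1 => fun v =>
      alg.receive (run alg B I ω t v) fun p =>
        if h : p < I.net.deg v then
          (alg.send (run alg B I ω t (I.net.nbr v ⟨p, h⟩)) (I.net.backPort v ⟨p, h⟩)).take B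
        else []

noncomputable def result (alg : Algorithm) (B : ℕ) (I : Instance V) (ω : ℕ → Bool) (v : V) :
    ℕ → ℕ → EdgeLabel :=
  alg.output (alg.run B I ω (alg.rounds (Fintype.card V) I.congestion I.dilation) v)

end Algorithm

/-- The outputs `out` of the nodes describe, for every tree of the instance, its orientation and
the decomposition `P i`: both endpoints of each edge of a tree know which of them is the parent, and
whether the edge is the first edge of its path. (A downward edge that is not first continues the
path of the edge above it, so this determines the paths.) -/
def Instance.Describes {V : Type} (I : Instance V) (P : ℕ → Finset (List V))
    (out : V → ℕ → ℕ → EdgeLabel) : Prop :=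
  ∀ i ∈ I.ids, ∀ (v : V) (p : Fin (I.net.deg v)),
    (I.tree i).toSubgraph.Adj v (I.net.nbr v p) →
      ((out v i p).toParent = true ↔ (I.tree i).IsChild (I.net.nbr v p) v) ∧
      ((out v i p).first = true ↔
        ∃ q ∈ P i, [I.net.nbr v p, v] <+: q ∨ [v, I.net.nbr v p] <+: q)

/-- The outputs `out` of the nodes form an `(l, k)`-short path decomposition of all trees. -/
def Instance.IsShortDecomposition {V : Type} [Fintype V] (I : Instance V) (l k : ℝ)
    (out : V → ℕ → ℕ → EdgeLabel) : Prop :=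
  ∃ P : ℕ → Finset (List V),
    (∀ i ∈ I.ids, (I.tree i).IsPathDecomposition (P i) ∧ (I.tree i).IsShort (P i) l k) ∧
    I.Describes P out

/-- The law of an infinite sequence of independent fair random bits. -/
noncomputable def fairBits : MeasureTheory.Measure (ℕ → Bool) :=
  MeasureTheory.Measure.infinitePi fun _ => (PMF.uniformOfFintype Bool).toMeasure

end Multicast

/-! The decomposition is a heavy path decomposition by coarse subtree sizes. From the leaves upward,
a vertex gets the largest rank `r` with `2 ^ r ≤ 2 + ∑ (2 ^ r_c - 1)`, summed over the ranks `r_c`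
of its children. So `2 ^ r - 1` is at most the size of the subtree, and a rank takes only `O(log log
n)` bits. At most one child has the rank of its parent, so the edges of constant rank form
descending paths; edges at the root always start a new path. On a root-to-leaf path every later
change of path lowers the rank, which gives at most `log₂ n` paths (`isShort_decomposition`),
without the term `d / ℓ`.

For the computation, each tree takes a delay below `2 ^ ⌈log₂ C⌉` from the shared bits and is
processed one level per step: a token goes down and orients the edges, ranks go up in reversed time,
and marks of topmost edges go down. At least `k` trees meet on an edge at a given time with
probability at most `1 / k!` (`fairBits_load_le`); for `k` of order `log n / log log n` a union
bound gives the failure probability.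

To save bandwidth, a message names a tree only among those that could use the edge now: their delays
lie among the last `D + 1` times, and both endpoints know them. Few trees share a delay, so there
are at most `min C ((D + 1) k)` candidates, and an item of a message costs `log min{C, D} + O(log
log n)` bits. Hence a step fits into `O(1 + log min{C, D} / log log n)` rounds (`card_codebook_le`,
`chunks_le`), and there are `O(C + D)` steps. Correctness compares the run with the intended
messages: these obey the local rule of the algorithm (`message_eq_ideal`), and without overload they
are what is transmitted (`Good.followsIdeal`). -/

namespace Multicast

namespace RootedTree

/-! ### Levels and parents in a rooted tree -/

section Levels

variable {V : Type} {G : SimpleGraph V} (T : RootedTree G)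

/-- A walk that starts in the tree never leaves it, because the edges of `spanningCoe` are tree
edges. This transfers distances from the spanning graph, where levels are defined, to the tree. -/
theorem exists_walk_coe {u v : V} (p : T.toSubgraph.spanningCoe.Walk u v)
    (hu : u ∈ T.toSubgraph.verts) :
    ∃ (hv : v ∈ T.toSubgraph.verts) (q : T.toSubgraph.coe.Walk ⟨u, hu⟩ ⟨v, hv⟩),
      q.length = p.length := by
  induction p with
  | nil => exact ⟨hu, .nil, rfl⟩
  | cons h p ih =>
    have h' : T.toSubgraph.Adj _ _ := h
    obtain ⟨hv, q, hq⟩ := ih h'.snd_mem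
    exact ⟨hv, .cons (show T.toSubgraph.coe.Adj ⟨_, hu⟩ ⟨_, h'.snd_mem⟩ from h') q, by simp [hq]⟩

theorem level_eq_coe_dist {v : V} (hv : v ∈ T.toSubgraph.verts) :
    T.level v = T.toSubgraph.coe.dist ⟨T.root, T.root_mem⟩ ⟨v, hv⟩ := by
  obtain ⟨q, hq⟩ := T.isTree.connected.exists_walk_length_eq_dist ⟨T.root, T.root_mem⟩ ⟨v, hv⟩
  let q' : T.toSubgraph.spanningCoe.Walk T.root v :=
    q.map (T.toSubgraph.coeEmbeddingSpanningCoe.toHom)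
  apply le_antisymm
  · rw [← hq]
    exact (SimpleGraph.dist_le q').trans (SimpleGraph.Walk.length_map _ _).le
  · have hr : T.toSubgraph.spanningCoe.Reachable T.root v := ⟨q'⟩
    obtain ⟨p, hp⟩ := hr.exists_walk_length_eq_dist
    obtain ⟨hv', p', hp'⟩ := T.exists_walk_coe p T.root_mem
    rw [level, ← hp, ← hp']
    exact SimpleGraph.dist_le p'

@[simp]
theorem level_root : T.level T.root = 0 := by simp [level]

variable {T}

theorem level_eq_zero_iff {v : V} (hv : v ∈ T.toSubgraph.verts) :
    T.level v = 0 ↔ v = T.root := by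
  rw [T.level_eq_coe_dist hv, T.isTree.connected.dist_eq_zero_iff, Subtype.mk.injEq, eq_comm]

theorem IsChild.ne_root {u v : V} (h : T.IsChild u v) : v ≠ T.root := by
  rintro rfl
  have := h.2
  simp at this

theorem isChild_or_isChild {u v : V} (h : T.toSubgraph.Adj u v) :
    T.IsChild u v ∨ T.IsChild v u := by
  have h' : T.toSubgraph.coe.Adj ⟨u, h.fst_mem⟩ ⟨v, h.snd_mem⟩ := h
  have := T.isTree.dist_eq_dist_add_one_of_adj ⟨T.root, T.root_mem⟩ h'
  rw [← T.level_eq_coe_dist, ← T.level_eq_coe_dist] at this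
  rcases this with h1 | h1
  · exact .inr ⟨h.symm, h1⟩
  · exact .inl ⟨h, h1⟩

theorem exists_isChild {v : V} (hv : v ∈ T.toSubgraph.verts) (h : v ≠ T.root) :
    ∃ u, T.IsChild u v := by
  obtain ⟨p, hp⟩ := T.isTree.connected.exists_walk_length_eq_dist ⟨v, hv⟩ ⟨T.root, T.root_mem⟩
  cases p with
  | nil => exact absurd rfl h
  | @cons _ w _ hvw p =>
    have h1 : T.toSubgraph.Adj v w := hvw
    rcases isChild_or_isChild h1.symm with h2 | h2
    · exact ⟨w, h2⟩
    · have h3 := SimpleGraph.dist_le p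
      rw [SimpleGraph.dist_comm, ← T.level_eq_coe_dist] at h3
      rw [SimpleGraph.dist_comm, ← T.level_eq_coe_dist, SimpleGraph.Walk.length_cons] at hp
      have := h2.2
      omega

/-- Appending the last edge to a shortest path from the root to any parent gives a shortest path to
`v`. A tree has only one path to `v`, and its penultimate vertex is the parent. -/
theorem IsChild.parent_unique {u u' v : V} (h : T.IsChild u v) (h' : T.IsChild u' v) :
    u = u' := by
  have hr : T.root ∈ T.toSubgraph.verts := T.root_mem
  obtain ⟨p, hpath, hp⟩ := T.isTree.connected.exists_path_of_dist ⟨T.root, hr⟩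
    ⟨v, h.1.snd_mem⟩
  rw [← T.level_eq_coe_dist] at hp
  have key : ∀ w (hw : T.IsChild w v),
      (⟨w, hw.1.fst_mem⟩ : T.toSubgraph.verts) = p.penultimate := by
    intro w hw
    obtain ⟨q, hqpath, hq⟩ := T.isTree.connected.exists_path_of_dist ⟨T.root, hr⟩
      ⟨w, hw.1.fst_mem⟩
    rw [← T.level_eq_coe_dist] at hq
    have hadj : T.toSubgraph.coe.Adj ⟨w, hw.1.fst_mem⟩ ⟨v, h.1.snd_mem⟩ := hw.1
    have h1 : (q.concat hadj).length = T.toSubgraph.coe.dist ⟨T.root, hr⟩ ⟨v, h.1.snd_mem⟩ := by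
      rw [SimpleGraph.Walk.length_concat, hq, ← T.level_eq_coe_dist, hw.2]
    have h2 := SimpleGraph.Walk.isPath_of_length_eq_dist _ h1
    have h3 := (T.isTree.isAcyclic.subsingleton_path _ _).elim ⟨_, h2⟩ ⟨p, hpath⟩
    have h4 : q.concat hadj = p := congrArg Subtype.val h3
    rw [← h4]
    simp
  have := (key u h).trans (key u' h').symm
  simpa using this

theorem IsChild.not_isChild {u v : V} (h : T.IsChild u v) : ¬ T.IsChild v u := by
  intro h'
  have := h.2
  have := h'.2
  omega

theorem level_le_depth [Fintype V] (v : V) : T.level v ≤ T.depth :=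
  Finset.le_sup (f := T.level) (Finset.mem_univ v)

theorem IsChild.level_lt_depth [Fintype V] {u v : V} (h : T.IsChild u v) :
    T.level u < T.depth := by
  have := T.level_le_depth v
  have := h.2
  omega

theorem level_lt_card [Fintype V] (v : V) : T.level v < Fintype.card V := by
  by_cases h : T.level v = 0
  · rw [h]
    exact Fintype.card_pos_iff.2 ⟨v⟩
  · obtain ⟨p, hp, hl⟩ := (SimpleGraph.Reachable.of_dist_ne_zero h).exists_path_of_dist
    rw [level, ← hl]
    exact hp.length_lt

end Levels

/-! ### Ranks as rounded logarithms of subtree sizes -/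

section Rank

variable {V : Type} [Fintype V] {G : SimpleGraph V} (T : RootedTree G)

open Classical in
noncomputable def children (v : V) : Finset V := Finset.univ.filter (T.IsChild v)

@[simp]
theorem mem_children {u v : V} : v ∈ T.children u ↔ T.IsChild u v := by
  simp [children]

/-- The recursion that defines the rank of a vertex, with fuel. -/
noncomputable def rankAux : ℕ → V → ℕ
  | 0, _ => 1
  | m + 1, v => Nat.log 2 (2 + ∑ c ∈ T.children v, (2 ^ rankAux m c - 1))

/-- A rounded measure of the logarithm of the size of the subtree below a vertex, which
determines the heavy edges: those between vertices of the same rank. -/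
noncomputable def rank (v : V) : ℕ := T.rankAux (T.depth + 1 - T.level v) v

theorem rank_eq (v : V) :
    T.rank v = Nat.log 2 (2 + ∑ c ∈ T.children v, (2 ^ T.rank c - 1)) := by
  have hd := T.level_le_depth v
  obtain ⟨m, hm⟩ : ∃ m, T.depth + 1 - T.level v = m + 1 := ⟨T.depth - T.level v, by omega⟩
  rw [rank, hm, rankAux]
  congr 2
  refine Finset.sum_congr rfl fun c hc => ?_
  rw [mem_children] at hc
  rw [rank, hc.2, show T.depth + 1 - (T.level v + 1) = m by omega]

theorem one_le_rank (v : V) : 1 ≤ T.rank v := by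
  rw [rank_eq]
  exact Nat.log_pos (by norm_num) (by omega)

theorem two_pow_rank_le (v : V) :
    2 ^ T.rank v ≤ 2 + ∑ c ∈ T.children v, (2 ^ T.rank c - 1) := by
  conv_lhs => rw [rank_eq]
  exact Nat.pow_log_le_self 2 (by omega)

variable {T}

theorem IsChild.rank_le {u v : V} (h : T.IsChild u v) : T.rank v ≤ T.rank u := by
  rw [T.rank_eq u]
  apply Nat.le_log_of_pow_le (by norm_num)
  have := Finset.single_le_sum (f := fun c => 2 ^ T.rank c - 1) (fun _ _ => Nat.zero_le _)
    (T.mem_children.2 h)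
  have := Nat.one_le_two_pow (n := T.rank v)
  omega

/-- Two children of the parent's rank `r` would contribute `2 + 2 * (2 ^ r - 1) = 2 ^ (r + 1)` and
so raise the rank of the parent. -/
theorem IsChild.heavy_unique {u v w : V} (hv : T.IsChild u v) (hw : T.IsChild u w)
    (hrv : T.rank v = T.rank u) (hrw : T.rank w = T.rank u) : v = w := by
  classical
  by_contra hne
  have h1 : T.rank u + 1 ≤ T.rank u := by
    conv_rhs => rw [T.rank_eq u]
    apply Nat.le_log_of_pow_le (by norm_num)
    have h2 : ∑ c ∈ {v, w}, (2 ^ T.rank c - 1) ≤ ∑ c ∈ T.children u, (2 ^ T.rank c - 1) := by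
      apply Finset.sum_le_sum_of_subset
      intro c hc
      rw [Finset.mem_insert, Finset.mem_singleton] at hc
      rcases hc with rfl | rfl <;> simpa
    rw [Finset.sum_pair hne, hrv, hrw] at h2
    have := Nat.one_le_two_pow (n := T.rank u)
    rw [pow_succ]
    omega
  omega

open Classical in
-- The weight `2 ^ rank - 1` of a vertex exceeds the total weight of its children by at most one.
-- Summing over a level carries the bound from level `j + 1` up to level `j`.
theorem sum_rank_level_le (m j : ℕ) (h : T.depth + 1 ≤ j + m) :
    ∑ v ∈ Finset.univ.filter (fun v => v ∈ T.toSubgraph.verts ∧ T.level v = j),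
      (2 ^ T.rank v - 1) ≤
    (Finset.univ.filter (fun v => v ∈ T.toSubgraph.verts ∧ j ≤ T.level v)).card := by
  induction m generalizing j with
  | zero =>
    rw [Finset.filter_false_of_mem]
    · simp
    · intro v _ hv
      have := T.level_le_depth v
      omega
  | succ m ih =>
    have ih := ih (j + 1) (by omega)
    have h1 : ∑ v ∈ Finset.univ.filter (fun v => v ∈ T.toSubgraph.verts ∧ T.level v = j),
        (2 ^ T.rank v - 1) ≤
        ∑ v ∈ Finset.univ.filter (fun v => v ∈ T.toSubgraph.verts ∧ T.level v = j),
          (1 + ∑ c ∈ T.children v, (2 ^ T.rank c - 1)) := by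
      refine Finset.sum_le_sum fun v _ => ?_
      have := T.two_pow_rank_le v
      omega
    have h2 : ∑ v ∈ Finset.univ.filter (fun v => v ∈ T.toSubgraph.verts ∧ T.level v = j),
          ∑ c ∈ T.children v, (2 ^ T.rank c - 1) ≤
        ∑ v ∈ Finset.univ.filter (fun v => v ∈ T.toSubgraph.verts ∧ T.level v = j + 1),
          (2 ^ T.rank v - 1) := by
      rw [← Finset.sum_biUnion]
      · apply Finset.sum_le_sum_of_subset
        intro c hc
        simp only [Finset.mem_biUnion, Finset.mem_filter, Finset.mem_univ, true_and,
          mem_children] at hc ⊢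
        obtain ⟨v, hv, hvc⟩ := hc
        exact ⟨hvc.1.snd_mem, by rw [hvc.2, hv.2]⟩
      · intro v _ w _ hvw
        rw [Function.onFun, Finset.disjoint_left]
        intro c hc hc'
        rw [mem_children] at hc hc'
        exact hvw (hc.parent_unique hc')
    have h3 : (Finset.univ.filter (fun v => v ∈ T.toSubgraph.verts ∧ T.level v = j)).card +
        (Finset.univ.filter (fun v => v ∈ T.toSubgraph.verts ∧ j + 1 ≤ T.level v)).card ≤
        (Finset.univ.filter (fun v => v ∈ T.toSubgraph.verts ∧ j ≤ T.level v)).card := by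
      rw [← Finset.card_union_of_disjoint]
      · apply Finset.card_le_card
        intro v hv
        simp only [Finset.mem_union, Finset.mem_filter, Finset.mem_univ, true_and] at hv ⊢
        rcases hv with hv | hv
        · exact ⟨hv.1, hv.2.ge⟩
        · exact ⟨hv.1, by omega⟩
      · rw [Finset.disjoint_left]
        intro v hv hv'
        simp only [Finset.mem_filter] at hv hv'
        omega
    rw [Finset.sum_add_distrib, Finset.sum_const, smul_eq_mul, mul_one] at h1
    omega

/-- The root is not counted at or below the level of `v`, so the weight of `v` is at most `n - 1`.
This missing vertex cancels the `-1` in the weight. -/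
theorem IsChild.two_pow_rank_le_card {u v : V} (h : T.IsChild u v) :
    2 ^ T.rank v ≤ Fintype.card V := by
  classical
  have hv := h.1.snd_mem
  have h1 := T.sum_rank_level_le (T.depth + 1) (T.level v) (by omega)
  have h2 : 2 ^ T.rank v - 1 ≤ _ := Finset.single_le_sum (f := fun v => 2 ^ T.rank v - 1)
    (s := Finset.univ.filter (fun w => w ∈ T.toSubgraph.verts ∧ T.level w = T.level v))
    (fun _ _ => Nat.zero_le _) (by simpa using hv)
  have h3 : (Finset.univ.filter
      (fun w => w ∈ T.toSubgraph.verts ∧ T.level v ≤ T.level w)).card < Fintype.card V := by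
    rw [← Finset.card_univ]
    apply Finset.card_lt_card
    rw [Finset.ssubset_univ_iff]
    intro h'
    have h4 := Finset.mem_univ T.root
    rw [← h'] at h4
    have := h.2
    simp at h4
    omega
  omega

end Rank

end RootedTree

end Multicast

/-! ### The heavy path decomposition -/

namespace Multicast

/-- Every entry of `l` is preceded in the list by an element related to it. Since `R` determines
predecessors, the element before `y` must be `x`. -/
theorem pair_infix_cons_iff {α : Type} {R : α → α → Prop}
    (hR : ∀ a b c, R a c → R b c → a = b) {x y u : α} {l : List α} (hxy : R x y)
    (hl : (u :: l).IsChain R) : [x, y] <:+: u :: l ↔ y ∈ l := by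
  constructor
  · intro h
    rcases List.infix_cons_iff.1 h with h | h
    · rw [List.cons_prefix_cons] at h
      exact h.2.subset (List.mem_singleton_self y)
    · exact h.subset (by simp)
  · intro h
    induction l generalizing u with
    | nil => simp at h
    | cons a l ih =>
      rw [List.isChain_cons_cons] at hl
      rcases List.mem_cons.1 h with rfl | h
      · obtain rfl := hR _ _ _ hxy hl.1
        exact List.IsPrefix.isInfix (by simp)
      · exact List.infix_cons (ih hl.2 h)

namespace RootedTree

variable {V : Type} [Fintype V] {G : SimpleGraph V} (T : RootedTree G)

/-- The edge from `u` down to its child `v` is the topmost edge of its path. -/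
def First (u v : V) : Prop := T.IsChild u v ∧ (u = T.root ∨ T.rank v ≠ T.rank u)

/-- The edge from `u` down to its child `v` continues the path of the edge above it. -/
def Heavy (u v : V) : Prop := T.IsChild u v ∧ u ≠ T.root ∧ T.rank v = T.rank u

open Classical in
/-- The heavy path that starts at a vertex, with fuel. -/
noncomputable def heavyPathAux : ℕ → V → List V
  | 0, v => [v]
  | m + 1, v => if h : ∃ c, T.Heavy v c then v :: heavyPathAux m h.choose else [v]

/-- The fuel is the number of levels below `v`, so the recursion never stops above a heavy edge. -/
noncomputable def heavyPath (v : V) : List V := T.heavyPathAux (T.depth - T.level v) v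

open Classical in
/-- The decomposition into the paths that consist of a first edge and the heavy path below. -/
noncomputable def decomposition : Finset (List V) :=
  (Finset.univ.filter fun e : V × V => T.First e.1 e.2).image fun e => e.1 :: T.heavyPath e.2

variable {T}

theorem mem_decomposition {p : List V} :
    p ∈ T.decomposition ↔ ∃ u w, T.First u w ∧ u :: T.heavyPath w = p := by
  simp [decomposition]

theorem Heavy.unique {u v w : V} (hv : T.Heavy u v) (hw : T.Heavy u w) : v = w :=
  hv.1.heavy_unique hw.1 hv.2.2 hw.2.2

theorem First.not_heavy {u v w : V} (h : T.First u v) : ¬ T.Heavy w v := by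
  intro h'
  obtain rfl := h.1.parent_unique h'.1
  rcases h.2 with h2 | h2
  · exact h'.2.1 h2
  · exact h2 h'.2.2

theorem IsChild.first_or_heavy {u v : V} (h : T.IsChild u v) : T.First u v ∨ T.Heavy u v := by
  by_cases h1 : u = T.root
  · exact .inl ⟨h, .inl h1⟩
  · by_cases h2 : T.rank v = T.rank u
    · exact .inr ⟨h, h1, h2⟩
    · exact .inl ⟨h, .inr h2⟩

theorem Heavy.heavyPath_eq {v c : V} (h : T.Heavy v c) :
    T.heavyPath v = v :: T.heavyPath c := by
  have h1 := h.1.level_lt_depth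
  have hex : ∃ c, T.Heavy v c := ⟨c, h⟩
  rw [heavyPath, heavyPath, h.1.2,
    show T.depth - T.level v = (T.depth - (T.level v + 1)) + 1 by omega, heavyPathAux,
    dif_pos hex, hex.choose_spec.unique h]

theorem heavyPath_eq_singleton {v : V} (h : ¬ ∃ c, T.Heavy v c) : T.heavyPath v = [v] := by
  rw [heavyPath]
  cases T.depth - T.level v with
  | zero => rfl
  | succ m => rw [heavyPathAux, dif_neg h]

theorem heavyPath_eq_cons (v : V) : ∃ l, T.heavyPath v = v :: l := by
  by_cases h : ∃ c, T.Heavy v c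
  · obtain ⟨c, hc⟩ := h
    exact ⟨_, hc.heavyPath_eq⟩
  · exact ⟨_, heavyPath_eq_singleton h⟩

/-- Induction from the bottom of the tree along heavy edges. -/
theorem heavy_induction {motive : V → Prop}
    (step : ∀ v c, T.Heavy v c → motive c → motive v)
    (base : ∀ v, (¬ ∃ c, T.Heavy v c) → motive v) (v : V) : motive v := by
  induction h : T.depth - T.level v using Nat.strong_induction_on generalizing v with
  | _ m ih =>
    by_cases hex : ∃ c, T.Heavy v c
    · obtain ⟨c, hc⟩ := hex
      refine step v c hc (ih _ ?_ c rfl)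
      have := hc.1.level_lt_depth
      have := hc.1.2
      omega
    · exact base v hex

theorem isChain_heavyPath (v : V) : (T.heavyPath v).IsChain T.IsChild := by
  induction v using T.heavy_induction with
  | step v c h ih =>
    obtain ⟨l, hl⟩ := T.heavyPath_eq_cons c
    rw [h.heavyPath_eq]
    rw [hl] at ih ⊢
    exact List.IsChain.cons_cons h.1 ih
  | base v h =>
    rw [heavyPath_eq_singleton h]
    simp

theorem mem_heavyPath {v y : V} :
    y ∈ T.heavyPath v ↔ Relation.ReflTransGen T.Heavy v y := by
  induction v using T.heavy_induction with
  | step v c h ih =>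
    rw [h.heavyPath_eq, List.mem_cons, ih]
    constructor
    · rintro (rfl | h')
      · exact .refl
      · exact .head h h'
    · intro h'
      rcases h'.cases_head with rfl | ⟨d, hd, h'⟩
      · exact .inl rfl
      · obtain rfl := hd.unique h
        exact .inr h'
  | base v h =>
    rw [heavyPath_eq_singleton h, List.mem_singleton]
    constructor
    · rintro rfl
      exact .refl
    · intro h'
      rcases h'.cases_head with rfl | ⟨d, hd, h'⟩
      · rfl
      · exact absurd ⟨d, hd⟩ h

theorem IsChild.isChain_cons_heavyPath {u v : V} (h : T.IsChild u v) :
    (u :: T.heavyPath v).IsChain T.IsChild := by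
  have h1 := T.isChain_heavyPath v
  obtain ⟨l, hl⟩ := T.heavyPath_eq_cons v
  rw [hl] at h1 ⊢
  exact List.IsChain.cons_cons h h1

theorem pair_infix_path_iff {x y u v : V} (hxy : T.IsChild x y) (h : T.IsChild u v) :
    [x, y] <:+: u :: T.heavyPath v ↔ Relation.ReflTransGen T.Heavy v y := by
  rw [pair_infix_cons_iff (fun _ _ _ h h' => h.parent_unique h') hxy h.isChain_cons_heavyPath,
    mem_heavyPath]

/-- Climb along heavy edges until a first edge appears; this happens at the root at the latest,
where no edge is heavy. -/
theorem exists_first_reflTransGen {x y : V} (hxy : T.IsChild x y) :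
    ∃ u v, T.First u v ∧ Relation.ReflTransGen T.Heavy v y := by
  induction h : T.level x generalizing x y with
  | zero =>
    refine ⟨x, y, ⟨hxy, .inl ((T.level_eq_zero_iff hxy.1.fst_mem).1 h)⟩, .refl⟩
  | succ m ih =>
    rcases hxy.first_or_heavy with h1 | h1
    · exact ⟨x, y, h1, .refl⟩
    · obtain ⟨z, hz⟩ := T.exists_isChild hxy.1.fst_mem h1.2.1
      obtain ⟨u, v, huv, hv⟩ := ih hz (by have := hz.2; omega)
      exact ⟨u, v, huv, hv.tail h1⟩

/-- Parents are unique, so two heavy chains that end at `y` agree upwards, and neither continues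
above the lower end of a first edge. -/
theorem First.unique_of_reflTransGen {u v u' v' y : V} (h : T.First u v) (h' : T.First u' v')
    (hy : Relation.ReflTransGen T.Heavy v y) (hy' : Relation.ReflTransGen T.Heavy v' y) :
    v = v' := by
  induction hy with
  | refl =>
    rcases hy'.cases_tail with h1 | ⟨z, -, hz⟩
    · exact h1
    · exact absurd hz h.not_heavy
  | tail _ hbc ih =>
    rcases hy'.cases_tail with rfl | ⟨z, hz', hz⟩
    · exact absurd hbc h'.not_heavy
    · obtain rfl := hz.1.parent_unique hbc.1
      exact ih hz'

variable (T) in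
theorem isPathDecomposition_decomposition : T.IsPathDecomposition T.decomposition := by
  constructor
  · intro p hp
    obtain ⟨u, w, h, rfl⟩ := mem_decomposition.1 hp
    refine ⟨?_, h.1.isChain_cons_heavyPath⟩
    obtain ⟨l, hl⟩ := T.heavyPath_eq_cons w
    simp [hl]
  · intro x y hxy
    obtain ⟨u, v, huv, hv⟩ := exists_first_reflTransGen hxy
    refine ⟨u :: T.heavyPath v, ⟨mem_decomposition.2 ⟨u, v, huv, rfl⟩,
      (pair_infix_path_iff hxy huv.1).2 hv⟩, ?_⟩
    rintro p ⟨hp, hp'⟩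
    obtain ⟨u', v', huv', rfl⟩ := mem_decomposition.1 hp
    rw [pair_infix_path_iff hxy huv'.1] at hp'
    obtain rfl := huv'.unique_of_reflTransGen huv hp' hv
    rw [huv'.1.parent_unique huv.1]

theorem exists_pair_prefix_iff {u v : V} :
    (∃ q ∈ T.decomposition, [u, v] <+: q) ↔ T.First u v := by
  constructor
  · rintro ⟨q, hq, h⟩
    obtain ⟨u', w, hw, rfl⟩ := mem_decomposition.1 hq
    obtain ⟨l, hl⟩ := T.heavyPath_eq_cons w
    rw [hl, List.cons_prefix_cons, List.cons_prefix_cons] at h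
    obtain ⟨rfl, rfl, -⟩ := h
    exact hw
  · intro h
    refine ⟨_, mem_decomposition.2 ⟨u, v, h, rfl⟩, ?_⟩
    obtain ⟨l, hl⟩ := T.heavyPath_eq_cons v
    simp [hl]

open Classical in
-- The edge from `x` to `y` lies on one path, and ranks are at least one. Further down, each first
-- edge lowers the rank, since its upper end is not the root, and each heavy edge adds no new path.
theorem card_filter_decomposition_le (rest : List V) (x y : V)
    (h : (x :: y :: rest).IsChain T.IsChild) :
    (T.decomposition.filter
      fun p => ∃ u v, [u, v] <:+: p ∧ [u, v] <:+: x :: y :: rest).card ≤ T.rank y := by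
  induction rest generalizing x y with
  | nil =>
    rw [List.isChain_cons_cons] at h
    refine le_trans ?_ (T.one_le_rank y)
    rw [Finset.card_le_one]
    have key : ∀ p, (∃ u v, [u, v] <:+: p ∧ [u, v] <:+: [x, y]) → [x, y] <:+: p := by
      rintro p ⟨u, v, hp, h'⟩
      rwa [← h'.eq_of_length rfl]
    intro p hp q hq
    rw [Finset.mem_filter] at hp hq
    exact (T.isPathDecomposition_decomposition.2 x y h.1).unique ⟨hp.1, key p hp.2⟩
      ⟨hq.1, key q hq.2⟩
  | cons z rest ih =>
    rw [List.isChain_cons_cons] at h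
    have ih := ih y z h.2
    rw [List.isChain_cons_cons] at h
    obtain ⟨hxy, hyz, -⟩ := h
    have hsub : (T.decomposition.filter
        fun p => ∃ u v, [u, v] <:+: p ∧ [u, v] <:+: x :: y :: z :: rest) ⊆
        (T.decomposition.filter fun p => [x, y] <:+: p) ∪
        (T.decomposition.filter
          fun p => ∃ u v, [u, v] <:+: p ∧ [u, v] <:+: y :: z :: rest) := by
      intro p hp
      rw [Finset.mem_union, Finset.mem_filter, Finset.mem_filter]
      rw [Finset.mem_filter] at hp
      obtain ⟨hp, u, v, h1, h2⟩ := hp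
      rcases List.infix_cons_iff.1 h2 with h2 | h2
      · rw [List.cons_prefix_cons, List.cons_prefix_cons] at h2
        obtain ⟨rfl, rfl, -⟩ := h2
        exact .inl ⟨hp, h1⟩
      · exact .inr ⟨hp, u, v, h1, h2⟩
    rcases hyz.first_or_heavy with h1 | h1
    · have h2 : T.rank z ≠ T.rank y := h1.2.resolve_left hxy.ne_root
      have h3 := hyz.rank_le
      have h4 : (T.decomposition.filter fun p => [x, y] <:+: p).card ≤ 1 := by
        rw [Finset.card_le_one]
        intro p hp q hq
        rw [Finset.mem_filter] at hp hq
        exact (T.isPathDecomposition_decomposition.2 x y hxy).unique hp hq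
      have h5 := (Finset.card_le_card hsub).trans (Finset.card_union_le _ _)
      omega
    · refine le_trans (Finset.card_le_card ?_) (ih.trans hyz.rank_le)
      -- The path through the edge `x y` also contains the heavy edge `y z`, so it is already
      -- counted.
      refine hsub.trans (Finset.union_subset ?_ (Finset.Subset.refl _))
      intro p hp
      rw [Finset.mem_filter] at hp ⊢
      refine ⟨hp.1, y, z, ?_, List.IsPrefix.isInfix (by simp)⟩
      obtain ⟨u, v, huv, rfl⟩ := mem_decomposition.1 hp.1
      rw [pair_infix_path_iff hxy huv.1] at hp
      rw [pair_infix_path_iff hyz huv.1]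
      exact hp.2.tail h1

variable (T) in
theorem isShort_decomposition {l k : ℝ} (hl : 0 ≤ l) (hk : Real.logb 2 (Fintype.card V) ≤ k) :
    T.IsShort T.decomposition l k := by
  classical
  intro q hq
  have hcard : (1 : ℝ) ≤ Fintype.card V := by
    exact_mod_cast Nat.one_le_iff_ne_zero.2 (Fintype.card_pos_iff.2 ⟨T.root⟩).ne'
  have hd : 0 ≤ (T.depth : ℝ) / l := by positivity
  have h0 : 0 ≤ Real.logb 2 (Fintype.card V) := Real.logb_nonneg (by norm_num) hcard
  obtain ⟨hq, hroot, -⟩ := hq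
  match q, hq, hroot with
  | [x], _, _ =>
    rw [Finset.filter_false_of_mem]
    · simp only [Finset.card_empty, Nat.cast_zero]
      linarith
    · rintro p - ⟨u, v, -, h⟩
      have := h.length_le
      simp at this
  | x :: y :: rest, hq, _ =>
    have h1 : T.IsChild x y := (List.isChain_cons_cons.1 hq).1
    have h2 := T.card_filter_decomposition_le rest x y hq
    have h3 : (T.rank y : ℝ) ≤ Real.logb 2 (Fintype.card V) := by
      rw [Real.le_logb_iff_rpow_le (by norm_num) (by linarith), Real.rpow_natCast]
      exact_mod_cast h1.two_pow_rank_le_card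
    have h4 : _ ≤ (T.rank y : ℝ) := Nat.cast_le.2 h2
    convert h4.trans (h3.trans (hk.trans (le_add_of_nonneg_left hd)))

end RootedTree

end Multicast

/-! ### Random delays and the load of an edge -/

namespace Multicast

open MeasureTheory
open scoped ENNReal Nat

/-- A random delay of `m` bits for the tree with identifier `i`. -/
def delay (m : ℕ) (ω : ℕ → Bool) (i : ℕ) : ℕ :=
  Nat.ofBits fun j : Fin m => ω (Nat.pair i j)

theorem delay_lt (m : ℕ) (ω : ℕ → Bool) (i : ℕ) : delay m ω i < 2 ^ m := Nat.ofBits_lt_two_pow _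

theorem testBit_delay {m : ℕ} (ω : ℕ → Bool) (i : ℕ) {j : ℕ} (hj : j < m) :
    (delay m ω i).testBit j = ω (Nat.pair i j) := Nat.testBit_ofBits_lt _ _ hj

theorem fairBits_cylinder (F : Finset ℕ) (a : ℕ → Bool) :
    fairBits {ω | ∀ x ∈ F, ω x = a x} = (2⁻¹ : ℝ≥0∞) ^ F.card := by
  have h : {ω : ℕ → Bool | ∀ x ∈ F, ω x = a x} = Set.pi (F : Set ℕ) fun x => {a x} := by
    ext ω
    simp
  rw [h, fairBits, Measure.infinitePi_pi _ fun _ _ => measurableSet_singleton _,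
    ← Finset.prod_const]
  refine Finset.prod_congr rfl fun x _ => ?_
  rw [PMF.toMeasure_apply_singleton _ _ (measurableSet_singleton _), PMF.uniformOfFintype_apply]
  simp

/-- Prescribing the delays fixes `m * S.card` distinct bits, as `Nat.pair` is injective. It is only
an inequality because `a i` may be out of range. -/
theorem fairBits_delay_eq_le (m : ℕ) (S : Finset ℕ) (a : ℕ → ℕ) :
    fairBits {ω | ∀ i ∈ S, delay m ω i = a i} ≤ (((2 : ℝ≥0∞) ^ m) ^ S.card)⁻¹ := by
  classical
  let F : Finset ℕ := (S ×ˢ Finset.range m).image fun x => Nat.pair x.1 x.2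
  have hF : F.card = m * S.card := by
    rw [Finset.card_image_of_injective, Finset.card_product, Finset.card_range, mul_comm]
    intro x y h
    exact Prod.ext (Nat.pair_eq_pair.1 h).1 (Nat.pair_eq_pair.1 h).2
  refine (measure_mono ?_).trans (fairBits_cylinder F
    fun x => (a (Nat.unpair x).1).testBit (Nat.unpair x).2).le |>.trans ?_
  · intro ω hω x hx
    obtain ⟨⟨i, j⟩, hij, rfl⟩ := Finset.mem_image.1 hx
    rw [Finset.mem_product, Finset.mem_range] at hij
    rw [Nat.unpair_pair, ← hω i hij.1, testBit_delay ω i hij.2]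
  · rw [hF, ← pow_mul, ENNReal.inv_pow]

/-- A union bound over the `k`-subsets of `E`: their number is at most `(2 ^ m) ^ k / k!`, and each
has its delays prescribed with probability at most `(2 ^ m) ^ (-k)`. -/
theorem fairBits_load_le {m : ℕ} {E : Finset ℕ} (hE : E.card ≤ 2 ^ m) (k : ℕ) (sh : ℕ → ℕ)
    (t : ℕ) :
    fairBits {ω | k ≤ (E.filter fun i => delay m ω i + sh i = t).card} ≤ ((k ! : ℕ) : ℝ≥0∞)⁻¹ := by
  have hsub : {ω | k ≤ (E.filter fun i => delay m ω i + sh i = t).card} ⊆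
      -- The truncated subtraction is harmless, because only this inclusion is needed.
      ⋃ S ∈ E.powersetCard k, {ω | ∀ i ∈ S, delay m ω i = t - sh i} := by
    intro ω hω
    obtain ⟨S, hS, hk⟩ := Finset.exists_subset_card_eq hω
    rw [Set.mem_iUnion₂]
    refine ⟨S, Finset.mem_powersetCard.2 ⟨hS.trans (Finset.filter_subset _ _), hk⟩, ?_⟩
    intro i hi
    have := (Finset.mem_filter.1 (hS hi)).2
    omega
  have h1 : fairBits {ω | k ≤ (E.filter fun i => delay m ω i + sh i = t).card} ≤
      (E.card.choose k : ℝ≥0∞) * (((2 : ℝ≥0∞) ^ m) ^ k)⁻¹ := by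
    refine (measure_mono hsub).trans ((measure_biUnion_finset_le _ _).trans ?_)
    rw [← Finset.card_powersetCard, ← nsmul_eq_mul]
    refine Finset.sum_le_card_nsmul _ _ _ fun S hS => ?_
    rw [← (Finset.mem_powersetCard.1 hS).2]
    exact fairBits_delay_eq_le m S _
  refine h1.trans ?_
  have h2 : k ! * E.card.choose k ≤ (2 ^ m) ^ k := by
    rw [← Nat.descFactorial_eq_factorial_mul_choose]
    exact (Nat.descFactorial_le_pow _ _).trans (Nat.pow_le_pow_left hE k)
  have h3 : ((k ! : ℕ) : ℝ≥0∞) ≠ 0 := by exact_mod_cast (Nat.factorial_pos k).ne'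
  rw [← div_eq_mul_inv, ENNReal.div_le_iff (by simp) (by finiteness), mul_comm, ← div_eq_mul_inv,
    ENNReal.le_div_iff_mul_le (.inl h3) (.inl (by simp)), mul_comm]
  exact_mod_cast h2

/-! ### Coding small sets by short bit strings -/

/-- A set of at most `k` elements arises from `k` choices among the elements of `S` and a blank. -/
theorem card_filter_powerset_card_le {α : Type} [DecidableEq α] (S : Finset α) (k : ℕ) :
    (S.powerset.filter fun s => s.card ≤ k).card ≤ (S.card + 1) ^ k := by
  induction k with
  | zero =>
    rw [pow_zero, Finset.card_le_one]
    intro a ha b hb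
    rw [Finset.mem_filter, Nat.le_zero, Finset.card_eq_zero] at ha hb
    rw [ha.2, hb.2]
  | succ k ih =>
    have hsub : (S.powerset.filter fun s => s.card ≤ k + 1) ⊆
        (Finset.insertNone S ×ˢ (S.powerset.filter fun s => s.card ≤ k)).image
          fun x => x.1.elim x.2 fun a => insert a x.2 := by
      intro s hs
      rw [Finset.mem_filter, Finset.mem_powerset] at hs
      rw [Finset.mem_image]
      rcases s.eq_empty_or_nonempty with rfl | ⟨a, ha⟩
      · exact ⟨(none, ∅), by simp, rfl⟩
      · refine ⟨(some a, s.erase a), ?_, by simp [ha]⟩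
        have := Finset.card_erase_of_mem ha
        simp only [Finset.mem_product, Finset.some_mem_insertNone, Finset.mem_filter,
          Finset.mem_powerset]
        exact ⟨hs.1 ha, (Finset.erase_subset _ _).trans hs.1, by omega⟩
    refine (Finset.card_le_card hsub).trans (Finset.card_image_le.trans ?_)
    rw [Finset.card_product, Finset.card_insertNone, pow_succ, mul_comm]
    exact Nat.mul_le_mul_right _ ih

theorem exists_code {α : Type} (S : Finset α) {B q : ℕ} (h : S.card ≤ 2 ^ (B * q)) :
    ∃ f : α → ℕ → List Bool, (∀ x r, (f x r).length ≤ B) ∧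
      ∀ x ∈ S, ∀ y ∈ S, (∀ r < q, f x r = f y r) → x = y := by
  classical
  have hcard : Fintype.card S ≤ Fintype.card (Fin q → Fin B → Bool) := by
    simpa [← pow_mul] using h
  obtain ⟨g⟩ := Function.Embedding.nonempty_of_card_le hcard
  refine ⟨fun x r => if hx : x ∈ S ∧ r < q then List.ofFn (g ⟨x, hx.1⟩ ⟨r, hx.2⟩) else [],
    fun x r => ?_, fun x hx y hy hxy => ?_⟩
  · dsimp only
    split_ifs <;> simp
  · have : g ⟨x, hx⟩ = g ⟨y, hy⟩ := by
      funext r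
      have := hxy r r.2
      dsimp only at this
      rw [dif_pos ⟨hx, r.2⟩, dif_pos ⟨hy, r.2⟩] at this
      exact List.ofFn_injective this
    simpa using g.injective this

open Classical in
/-- An encoding of the elements of `S` by `q` strings of at most `B` bits, injective if there are
enough such strings. -/
noncomputable def encode {α : Type} (S : Finset α) (B q : ℕ) : α → ℕ → List Bool :=
  if h : S.card ≤ 2 ^ (B * q) then (exists_code S h).choose else fun _ _ => []

open Classical in
-- Both endpoints of an edge hold the same `S`, hence the same chosen code, so the receiver can
-- search `S`. The default value occurs only if no element fits.
noncomputable def decode {α : Type} [Inhabited α] (S : Finset α) (B q : ℕ) (c : ℕ → List Bool) :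
    α :=
  if h : ∃ x ∈ S, ∀ r < q, encode S B q x r = c r then h.choose else default

theorem length_encode_le {α : Type} (S : Finset α) (B q : ℕ) (x : α) (r : ℕ) :
    (encode S B q x r).length ≤ B := by
  rw [encode]
  split_ifs with h
  · exact (exists_code S h).choose_spec.1 x r
  · simp

theorem decode_eq {α : Type} [Inhabited α] {S : Finset α} {B q : ℕ} (h : S.card ≤ 2 ^ (B * q))
    {x : α} (hx : x ∈ S) {c : ℕ → List Bool} (hc : ∀ r < q, c r = encode S B q x r) :
    decode S B q c = x := by
  have hex : ∃ x ∈ S, ∀ r < q, encode S B q x r = c r := ⟨x, hx, fun r hr => (hc r hr).symm⟩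
  rw [decode, dif_pos hex]
  have h1 := hex.choose_spec
  have h2 := (exists_code S h).choose_spec.2 hex.choose h1.1 x hx
  have h3 : encode S B q = (exists_code S h).choose := dif_pos h
  rw [← h3] at h2
  exact h2 fun r hr => (h1.2 r hr).trans (hc r hr)

end Multicast

/-! ### The algorithm -/

namespace Multicast

/-- The global parameters that every node knows, together with a constant `K` that determines the
failure probability. -/
structure Params where
  K : ℕ
  n : ℕ
  C : ℕ
  D : ℕ

namespace Params

variable (π : Params)

/-- The delays of the trees are numbers with this many bits. -/
def delayBits : ℕ := Nat.clog 2 π.C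

/-- The number of steps of each of the three phases. -/
def horizon : ℕ := 2 ^ π.delayBits + π.D

/-- A bound on the number of trees served by an edge in one step. -/
noncomputable def load : ℕ :=
  ⌈(π.K : ℝ) * Real.logb 2 π.n / Real.logb 2 (Real.logb 2 π.n)⌉₊

/-- The number of bits sent in one round. -/
def chunk : ℕ := Nat.log 2 π.n

/-- The number of bits that encode one item of a message. -/
noncomputable def width : ℕ :=
  Nat.clog 2 (min π.C ((π.D + 1) * π.load) * (Nat.log 2 π.n + 1) + 1)

/-- The number of rounds per step. -/
noncomputable def chunks : ℕ := π.load * π.width / π.chunk + 1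

noncomputable def rounds : ℕ :=
  if π.C = 0 ∨ π.D = 0 then 0 else 3 * π.horizon * π.chunks

/-- The time to which the delays refer in a step; in the second phase it runs backwards. -/
def clock (s : ℕ) : ℕ :=
  if s < π.horizon then s
  else if s < 2 * π.horizon then 2 * π.horizon - 1 - s
  else s - 2 * π.horizon

/-- The trees among `E` that may use an edge at time `τ`. -/
def candidates (ω : ℕ → Bool) (E : Finset ℕ) (τ : ℕ) : Finset ℕ :=
  E.filter fun i => delay π.delayBits ω i ≤ τ ∧ τ ≤ delay π.delayBits ω i + π.D

/-- The possible messages in a step along an edge contained in the trees `E`: sets of pairs of a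
tree identifier and a rank. -/
noncomputable def codebook (ω : ℕ → Bool) (E : Finset ℕ) (s : ℕ) : Finset (Finset (ℕ × ℕ)) :=
  (π.candidates ω E (π.clock s) ×ˢ Finset.range (Nat.log 2 π.n + 1)).powerset.filter
    fun M => M.card ≤ π.load

theorem two_pow_width_le : min π.C ((π.D + 1) * π.load) * (Nat.log 2 π.n + 1) + 1 ≤
    2 ^ π.width := Nat.le_pow_clog (by norm_num) _

theorem chunks_pos : 0 < π.chunks := Nat.succ_pos _

theorem load_mul_width_le (hn : 2 ≤ π.n) : π.load * π.width ≤ π.chunk * π.chunks := by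
  have h : 0 < π.chunk := Nat.log_pos (by norm_num) hn
  rw [chunks, mul_add, mul_one]
  exact (Nat.lt_mul_div_succ _ h).le

theorem clock_lt {s : ℕ} (hs : s < 3 * π.horizon) : π.clock s < π.horizon := by
  unfold clock
  split_ifs <;> omega

/-- The delays of the candidates at time `τ` lie in `[τ - D, τ]`, and each value occurs at most
`load` times. A message is then described by `load` items of `width` bits. -/
theorem card_codebook_le (hn : 2 ≤ π.n) {ω : ℕ → Bool} {E : Finset ℕ} (hE : E.card ≤ π.C)
    (hload : ∀ t < π.horizon, (E.filter fun i => delay π.delayBits ω i = t).card ≤ π.load)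
    {s : ℕ} (hs : s < 3 * π.horizon) :
    (π.codebook ω E s).card ≤ 2 ^ (π.chunk * π.chunks) := by
  have hτ := π.clock_lt hs
  set τ := π.clock s with hτ'
  have h1 : (π.candidates ω E τ).card ≤ π.C := (Finset.card_filter_le _ _).trans hE
  have h2 : (π.candidates ω E τ).card ≤ (π.D + 1) * π.load := by
    have hmaps : ∀ i ∈ π.candidates ω E τ, delay π.delayBits ω i ∈ Finset.Icc (τ - π.D) τ := by
      intro i hi
      have := (Finset.mem_filter.1 hi).2
      rw [Finset.mem_Icc]
      omega
    refine (Finset.card_le_mul_card_image_of_maps_to hmaps π.load fun t ht => ?_).trans ?_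
    · rw [Finset.mem_Icc] at ht
      refine le_trans (Finset.card_le_card ?_) (hload t (by omega))
      exact Finset.filter_subset_filter _ (Finset.filter_subset _ _)
    · rw [mul_comm]
      apply Nat.mul_le_mul_right
      rw [Nat.card_Icc]
      omega
  calc (π.codebook ω E s).card
      ≤ ((π.candidates ω E τ ×ˢ Finset.range (Nat.log 2 π.n + 1)).card + 1) ^ π.load :=
        card_filter_powerset_card_le _ _
    _ ≤ (2 ^ π.width) ^ π.load := by
        apply Nat.pow_le_pow_left
        refine le_trans ?_ π.two_pow_width_le
        rw [Finset.card_product, Finset.card_range]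
        exact Nat.succ_le_succ (Nat.mul_le_mul_right _ (le_min h1 h2))
    _ = 2 ^ (π.load * π.width) := by rw [← pow_mul, mul_comm]
    _ ≤ 2 ^ (π.chunk * π.chunks) := Nat.pow_le_pow_right (by norm_num) (π.load_mul_width_le hn)

end Params

namespace LocalInput

variable (inp : LocalInput)

def params (K : ℕ) : Params := ⟨K, inp.n, inp.C, inp.D⟩

/-- The trees that contain the edge at port `p`. -/
def edgeTrees (p : ℕ) : Finset ℕ := inp.trees.filter fun i => p ∈ inp.treePorts i

/-- The rank of a node in the tree `i`, computed from the messages `M p` of the children. -/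
def localRank (M : ℕ → Finset (ℕ × ℕ)) (i : ℕ) : ℕ :=
  Nat.log 2 (2 + ∑ p ∈ Finset.range inp.deg, ∑ x ∈ (M p).filter (fun x => x.1 = i), (2 ^ x.2 - 1))

open Classical in
/-- The message to be sent in step `s` through port `p`, where `M s' p'` is the message received in
an earlier step `s'` through port `p'`. First, a token travels down every tree. Then the ranks are
sent up. Finally, every node informs its children which of the edges to them are first edges. -/
noncomputable def message (π : Params) (ω : ℕ → Bool) (M : ℕ → ℕ → Finset (ℕ × ℕ)) (s p : ℕ) :
    Finset (ℕ × ℕ) :=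
  if s < π.horizon then
    ((inp.edgeTrees p).filter fun i => (i ∈ inp.rootOf ∧ delay π.delayBits ω i = s) ∨
      ∃ p' < inp.deg, p' ≠ p ∧ ∃ s', s' + 1 = s ∧ (i, 0) ∈ M s' p').image fun i => (i, 0)
  else if s < 2 * π.horizon then
    (M (2 * π.horizon - 1 - s) p).image fun x => (x.1, inp.localRank (M (s - 1)) x.1)
  else
    ((M (4 * π.horizon - 1 - s) p).filter fun x => x.1 ∈ inp.rootOf ∨
      x.2 ≠ inp.localRank (M (4 * π.horizon - 1 - s)) x.1).image fun x => (x.1, 0)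

end LocalInput

/-- The state of a node: its input, the random bits, the number of past rounds and all received
bit strings. -/
structure NodeState where
  input : LocalInput
  bits : ℕ → Bool
  time : ℕ
  log : ℕ → ℕ → List Bool

namespace NodeState

variable (st : NodeState) (K : ℕ)

/-- The decoded messages that have been received completely. -/
noncomputable def received (s p : ℕ) : Finset (ℕ × ℕ) :=
  let π := st.input.params K
  if (s + 1) * π.chunks ≤ st.time then
    decode (π.codebook st.bits (st.input.edgeTrees p) s) π.chunk π.chunks
      fun r => st.log (s * π.chunks + r) p
  else ∅

noncomputable def send (p : ℕ) : List Bool :=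
  let π := st.input.params K
  let s := st.time / π.chunks
  encode (π.codebook st.bits (st.input.edgeTrees p) s) π.chunk π.chunks
    (st.input.message π st.bits (st.received K) s p) (st.time % π.chunks)

def receive (c : ℕ → List Bool) : NodeState :=
  { st with time := st.time + 1, log := Function.update st.log st.time c }

open Classical in
noncomputable def output (i p : ℕ) : EdgeLabel :=
  let π := st.input.params K
  { toParent := decide (∃ s < π.horizon, (i, 0) ∈ st.received K s p)
    first := decide (∃ s, 2 * π.horizon ≤ s ∧ s < 3 * π.horizon ∧
      ((i, 0) ∈ st.received K s p ∨
        (i, 0) ∈ st.input.message π st.bits (st.received K) s p)) }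

end NodeState

/-- The algorithm that computes the decompositions of all trees with random delays. -/
noncomputable def pathAlgorithm (K : ℕ) : Algorithm where
  State := NodeState
  rounds n C D := (Params.mk K n C D).rounds
  init inp ω := ⟨inp, ω, 0, fun _ _ => []⟩
  send st p := st.send K p
  receive st c := st.receive c
  output st i p := st.output K i p

end Multicast

/-! ### The intended messages obey the local rule -/

namespace Multicast

namespace Network

variable {V : Type} (N : Network V)

theorem nbr_backPort (v : V) (p : Fin (N.deg v)) : N.nbr (N.nbr v p) (N.backPort v p) = v :=
  congrArg Subtype.val ((N.port (N.nbr v p)).apply_symm_apply ⟨v, (N.adj_nbr v p).symm⟩)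

theorem nbr_injective (v : V) : Function.Injective (N.nbr v) := by
  intro p q h
  exact (N.port v).injective (Subtype.ext h)

theorem exists_nbr_eq {v w : V} (h : N.graph.Adj v w) : ∃ p, N.nbr v p = w :=
  ⟨(N.port v).symm ⟨w, h⟩, by simp [nbr]⟩

end Network

namespace Instance

section

variable {V : Type} (I : Instance V)

open Classical in
noncomputable def edgeTrees (u w : V) : Finset ℕ :=
  I.ids.filter fun i => (I.tree i).toSubgraph.Adj u w

variable {I}

theorem mem_edgeTrees {i : ℕ} {u w : V} :
    i ∈ I.edgeTrees u w ↔ i ∈ I.ids ∧ (I.tree i).toSubgraph.Adj u w := by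
  simp [edgeTrees]

theorem edgeTrees_symm (u w : V) : I.edgeTrees u w = I.edgeTrees w u := by
  ext i
  rw [mem_edgeTrees, mem_edgeTrees, SimpleGraph.Subgraph.adj_comm]

end

variable {V : Type} [Fintype V] (I : Instance V) (K : ℕ) (ω : ℕ → Bool)

noncomputable def params : Params := ⟨K, Fintype.card V, I.congestion, I.dilation⟩

theorem params_localInput (v : V) : (I.localInput v).params K = I.params K := rfl

noncomputable def treeDelay (i : ℕ) : ℕ := delay (I.params K).delayBits ω i

open Classical in
/-- The message that `u` is supposed to send to `w` in step `s`. -/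
noncomputable def ideal (s : ℕ) (u w : V) : Finset (ℕ × ℕ) :=
  if s < (I.params K).horizon then
    (I.ids.filter fun i => (I.tree i).IsChild u w ∧
      I.treeDelay K ω i + (I.tree i).level u = s).image fun i => (i, 0)
  else if s < 2 * (I.params K).horizon then
    (I.ids.filter fun i => (I.tree i).IsChild w u ∧
      I.treeDelay K ω i + (I.tree i).level w + s + 1 = 2 * (I.params K).horizon).image
        fun i => (i, (I.tree i).rank u)
  else
    (I.ids.filter fun i => (I.tree i).First u w ∧
      I.treeDelay K ω i + (I.tree i).level u + 2 * (I.params K).horizon = s).image fun i => (i, 0)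

variable {I K ω}

theorem mem_ideal_down {s : ℕ} (hs : s < (I.params K).horizon) {u w : V} {i r : ℕ} :
    (i, r) ∈ I.ideal K ω s u w ↔ i ∈ I.ids ∧ (I.tree i).IsChild u w ∧
      I.treeDelay K ω i + (I.tree i).level u = s ∧ r = 0 := by
  rw [ideal, if_pos hs]
  simp only [Finset.mem_image, Finset.mem_filter, Prod.mk.injEq]
  constructor
  · rintro ⟨j, ⟨h1, h2, h3⟩, rfl, rfl⟩
    exact ⟨h1, h2, h3, rfl⟩
  · rintro ⟨h1, h2, h3, rfl⟩
    exact ⟨i, ⟨h1, h2, h3⟩, rfl, rfl⟩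

theorem mem_ideal_up {s : ℕ} (hs : (I.params K).horizon ≤ s) (hs' : s < 2 * (I.params K).horizon)
    {u w : V} {i r : ℕ} :
    (i, r) ∈ I.ideal K ω s u w ↔ i ∈ I.ids ∧ (I.tree i).IsChild w u ∧
      I.treeDelay K ω i + (I.tree i).level w + s + 1 = 2 * (I.params K).horizon ∧
      r = (I.tree i).rank u := by
  rw [ideal, if_neg hs.not_gt, if_pos hs']
  simp only [Finset.mem_image, Finset.mem_filter, Prod.mk.injEq]
  constructor
  · rintro ⟨j, ⟨h1, h2, h3⟩, rfl, rfl⟩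
    exact ⟨h1, h2, h3, rfl⟩
  · rintro ⟨h1, h2, h3, rfl⟩
    exact ⟨i, ⟨h1, h2, h3⟩, rfl, rfl⟩

theorem mem_ideal_first {s : ℕ} (hs : 2 * (I.params K).horizon ≤ s) {u w : V} {i r : ℕ} :
    (i, r) ∈ I.ideal K ω s u w ↔ i ∈ I.ids ∧ (I.tree i).First u w ∧
      I.treeDelay K ω i + (I.tree i).level u + 2 * (I.params K).horizon = s ∧ r = 0 := by
  rw [ideal, if_neg (by omega), if_neg (by omega)]
  simp only [Finset.mem_image, Finset.mem_filter, Prod.mk.injEq]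
  constructor
  · rintro ⟨j, ⟨h1, h2, h3⟩, rfl, rfl⟩
    exact ⟨h1, h2, h3, rfl⟩
  · rintro ⟨h1, h2, h3, rfl⟩
    exact ⟨i, ⟨h1, h2, h3⟩, rfl, rfl⟩

theorem treeDelay_add_level_lt {i : ℕ} (hi : i ∈ I.ids) {u w : V} (h : (I.tree i).IsChild u w) :
    I.treeDelay K ω i + (I.tree i).level u + 1 < (I.params K).horizon := by
  have h1 : (I.tree i).depth ≤ I.dilation := Finset.le_sup (f := fun i => (I.tree i).depth) hi
  have h2 := h.level_lt_depth
  have h3 : I.treeDelay K ω i < 2 ^ (I.params K).delayBits := delay_lt _ _ _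
  have h4 : (I.params K).horizon = 2 ^ (I.params K).delayBits + I.dilation := rfl
  omega

theorem edgeTrees_localInput (v : V) (p : Fin (I.net.deg v)) :
    (I.localInput v).edgeTrees p = I.edgeTrees v (I.net.nbr v p) := by
  ext i
  rw [mem_edgeTrees]
  rw [LocalInput.edgeTrees, Finset.mem_filter]
  simp only [localInput, Finset.mem_filter, Finset.mem_range]
  constructor
  · rintro ⟨-, -, h, _, h'⟩
    exact ⟨h, h'⟩
  · rintro ⟨h, h'⟩
    exact ⟨⟨h, h'.fst_mem⟩, p.2, h, p.2, h'⟩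

theorem mem_rootOf_localInput {v : V} {i : ℕ} :
    i ∈ (I.localInput v).rootOf ↔ i ∈ I.ids ∧ (I.tree i).root = v := by
  simp [localInput]

theorem card_edgeTrees_le (u w : V) : (I.edgeTrees u w).card ≤ I.congestion := by
  classical
  refine le_trans (le_of_eq ?_) (Finset.le_sup (f := fun e : Sym2 V =>
    (I.ids.filter fun i => e ∈ (I.tree i).toSubgraph.edgeSet).card) (Finset.mem_univ s(u, w)))
  simp only [SimpleGraph.Subgraph.mem_edgeSet]
  rw [edgeTrees]

theorem sum_children_eq (T : RootedTree I.net.graph) (v : V) (g : V → ℕ) (f : ℕ → ℕ)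
    (h1 : ∀ p : Fin (I.net.deg v), T.IsChild v (I.net.nbr v p) → f p = g (I.net.nbr v p))
    (h2 : ∀ p : Fin (I.net.deg v), ¬ T.IsChild v (I.net.nbr v p) → f p = 0) :
    ∑ p ∈ Finset.range (I.net.deg v), f p = ∑ c ∈ T.children v, g c := by
  classical
  rw [← Fin.sum_univ_eq_sum_range]
  have h3 : ∑ p : Fin (I.net.deg v), f p =
      ∑ p ∈ Finset.univ.filter (fun p => T.IsChild v (I.net.nbr v p)), g (I.net.nbr v p) := by
    rw [Finset.sum_filter]
    refine Finset.sum_congr rfl fun p _ => ?_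
    split_ifs with h
    · exact h1 p h
    · exact h2 p h
  rw [h3, ← Finset.sum_image (f := g) (fun p _ q _ h => I.net.nbr_injective v h)]
  congr 1
  ext c
  simp only [Finset.mem_image, Finset.mem_filter, Finset.mem_univ, true_and,
    RootedTree.mem_children]
  constructor
  · rintro ⟨p, hp, rfl⟩
    exact hp
  · intro h
    obtain ⟨p, rfl⟩ := I.net.exists_nbr_eq (T.toSubgraph.adj_sub h.1)
    exact ⟨p, h, rfl⟩

/-- In this step exactly the children of `v` in tree `i` report, each with one pair carrying its
rank, so the local sum is the one in `rank_eq`. -/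
theorem localRank_eq {v : V} {M : ℕ → ℕ → Finset (ℕ × ℕ)} {s i : ℕ} (hi : i ∈ I.ids)
    (hM : ∀ p : Fin (I.net.deg v), M s p = I.ideal K ω s (I.net.nbr v p) v)
    (hs : (I.params K).horizon ≤ s)
    (hv : I.treeDelay K ω i + (I.tree i).level v + s + 1 = 2 * (I.params K).horizon) :
    (I.localInput v).localRank (M s) i = (I.tree i).rank v := by
  rw [LocalInput.localRank, RootedTree.rank_eq]
  congr 2
  have hs' : s < 2 * (I.params K).horizon := by omega
  refine sum_children_eq (I.tree i) v (fun c => 2 ^ (I.tree i).rank c - 1) _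
    (fun p hp => ?_) (fun p hp => ?_)
  · have : (M s p).filter (fun x => x.1 = i) = {(i, (I.tree i).rank (I.net.nbr v p))} := by
      ext ⟨j, r⟩
      rw [Finset.mem_filter, hM p, mem_ideal_up hs hs', Finset.mem_singleton, Prod.mk.injEq]
      constructor
      · rintro ⟨⟨-, -, -, hr⟩, rfl⟩
        exact ⟨rfl, hr⟩
      · rintro ⟨rfl, rfl⟩
        exact ⟨⟨hi, hp, hv, rfl⟩, rfl⟩
    rw [this, Finset.sum_singleton]
  · rw [Finset.filter_false_of_mem, Finset.sum_empty]
    rintro ⟨j, r⟩ hj rfl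
    rw [hM p, mem_ideal_up hs hs'] at hj
    exact hp hj.2.1

/-- The root releases the token at its delay. Any other vertex gets it from its parent one step
earlier and passes it on through its other tree edges, all of which lead to children. -/
theorem message_down {v : V} {M : ℕ → ℕ → Finset (ℕ × ℕ)} {s : ℕ}
    (hs : s < (I.params K).horizon)
    (hM : ∀ s' < s, ∀ p : Fin (I.net.deg v), M s' p = I.ideal K ω s' (I.net.nbr v p) v)
    (p : Fin (I.net.deg v)) :
    (I.localInput v).message (I.params K) ω M s p = I.ideal K ω s v (I.net.nbr v p) := by
  classical
  rw [LocalInput.message, ideal, if_pos hs, if_pos hs]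
  congr 1
  ext i
  rw [Finset.mem_filter, Finset.mem_filter, edgeTrees_localInput, mem_edgeTrees, and_assoc]
  refine and_congr_right fun hi => ?_
  rw [mem_rootOf_localInput]
  change _ ∧ (_ ∧ I.treeDelay K ω i = s ∨ ∃ p' < I.net.deg v, _) ↔ _
  constructor
  · rintro ⟨hadj, ⟨⟨-, hroot⟩, hd⟩ | ⟨p', hp', hne, s', rfl, hmem⟩⟩
    · subst hroot
      refine ⟨(RootedTree.isChild_or_isChild hadj).resolve_right fun h => h.ne_root rfl, ?_⟩
      rw [RootedTree.level_root, hd, add_zero]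
    · have h1 := hM s' (Nat.lt_succ_self _) ⟨p', hp'⟩
      dsimp only at h1
      rw [h1, mem_ideal_down (by omega)] at hmem
      obtain ⟨-, hc, hd, -⟩ := hmem
      refine ⟨(RootedTree.isChild_or_isChild hadj).resolve_right fun h => hne ?_, ?_⟩
      · have := I.net.nbr_injective v (hc.parent_unique h)
        rw [← this]
      · rw [hc.2, ← hd, add_assoc]
  · rintro ⟨hc, hd⟩
    refine ⟨hc.1, ?_⟩
    by_cases hv : v = (I.tree i).root
    · left
      refine ⟨⟨hi, hv.symm⟩, ?_⟩
      rw [← hd, hv, RootedTree.level_root, add_zero]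
    · right
      obtain ⟨u, hu⟩ := RootedTree.exists_isChild hc.1.fst_mem hv
      obtain ⟨p', rfl⟩ := I.net.exists_nbr_eq ((I.tree i).toSubgraph.adj_sub hu.1.symm)
      have h1 := hu.2
      refine ⟨p', p'.2, fun h => ?_, s - 1, by omega, ?_⟩
      · rw [Fin.ext h] at hu
        exact hu.not_isChild hc
      · rw [hM _ (by omega), mem_ideal_down (by omega)]
        exact ⟨hi, hu, by omega, rfl⟩

/-- Step `2 * horizon - 1 - s` brought the token from the parent, so the token tells for which trees
to answer. The children are one level deeper and thus reported in step `s - 1`. -/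
theorem message_up {v : V} {M : ℕ → ℕ → Finset (ℕ × ℕ)} {s : ℕ}
    (hs : (I.params K).horizon ≤ s) (hs' : s < 2 * (I.params K).horizon)
    (hM : ∀ s' < s, ∀ p : Fin (I.net.deg v), M s' p = I.ideal K ω s' (I.net.nbr v p) v)
    (p : Fin (I.net.deg v)) :
    (I.localInput v).message (I.params K) ω M s p = I.ideal K ω s v (I.net.nbr v p) := by
  classical
  ext ⟨i, r⟩
  rw [LocalInput.message, if_neg hs.not_gt, if_pos hs', mem_ideal_up hs hs',
    hM _ (by omega), Finset.mem_image]
  have key : ∀ j ∈ I.ids, (I.tree j).IsChild (I.net.nbr v p) v →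
      I.treeDelay K ω j + (I.tree j).level (I.net.nbr v p) + s + 1 = 2 * (I.params K).horizon →
      (I.localInput v).localRank (M (s - 1)) j = (I.tree j).rank v := by
    intro j hj hc hd
    -- The spare step in this bound gives `horizon ≤ s - 1`, so the reports of the children belong
    -- to the second phase too.
    have h1 := treeDelay_add_level_lt (K := K) (ω := ω) hj hc
    have h2 := hc.2
    exact localRank_eq hj (hM _ (by omega)) (by omega) (by omega)
  constructor
  · rintro ⟨⟨j, r'⟩, hj, hjr⟩
    rw [mem_ideal_down (by omega)] at hj
    obtain ⟨hj, hc, hd, rfl⟩ := hj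
    rw [Prod.mk.injEq] at hjr
    obtain ⟨rfl, rfl⟩ := hjr
    dsimp only at hj hc hd ⊢
    exact ⟨hj, hc, by omega, key _ hj hc (by omega)⟩
  · rintro ⟨hi, hc, hd, rfl⟩
    refine ⟨(i, 0), ?_, ?_⟩
    · rw [mem_ideal_down (by omega)]
      exact ⟨hi, hc, by omega, rfl⟩
    · rw [key i hi hc hd]

/-- Step `4 * horizon - 1 - s` is the mirror image of `s` in the second phase. The children to be
informed now reported their ranks then, and the same reports determine the rank of `v`. -/
theorem message_first {v : V} {M : ℕ → ℕ → Finset (ℕ × ℕ)} {s : ℕ}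
    (hs : 2 * (I.params K).horizon ≤ s) (hs' : s < 3 * (I.params K).horizon)
    (hM : ∀ s' < s, ∀ p : Fin (I.net.deg v), M s' p = I.ideal K ω s' (I.net.nbr v p) v)
    (p : Fin (I.net.deg v)) :
    (I.localInput v).message (I.params K) ω M s p = I.ideal K ω s v (I.net.nbr v p) := by
  classical
  ext ⟨i, r⟩
  rw [LocalInput.message, if_neg (by omega), if_neg (by omega), mem_ideal_first hs,
    hM _ (by omega), Finset.mem_image]
  have key : ∀ j ∈ I.ids, (I.tree j).IsChild v (I.net.nbr v p) →
      I.treeDelay K ω j + (I.tree j).level v + 2 * (I.params K).horizon = s →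
      (I.localInput v).localRank (M (4 * (I.params K).horizon - 1 - s)) j =
        (I.tree j).rank v := by
    intro j hj hc hd
    have h1 := treeDelay_add_level_lt (K := K) (ω := ω) hj hc
    exact localRank_eq hj (hM _ (by omega)) (by omega) (by omega)
  constructor
  · rintro ⟨⟨j, r'⟩, hj, hjr⟩
    rw [Finset.mem_filter, mem_ideal_up (by omega) (by omega)] at hj
    obtain ⟨⟨hj, hc, hd, rfl⟩, hfirst⟩ := hj
    rw [Prod.mk.injEq] at hjr
    obtain ⟨rfl, rfl⟩ := hjr
    dsimp only at hfirst ⊢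
    rw [key j hj hc (by omega), mem_rootOf_localInput] at hfirst
    exact ⟨hj, ⟨hc, hfirst.imp (fun h => h.2.symm) id⟩, by omega, rfl⟩
  · rintro ⟨hi, hf, hd, rfl⟩
    refine ⟨(i, (I.tree i).rank (I.net.nbr v p)), ?_, rfl⟩
    rw [Finset.mem_filter, mem_ideal_up (by omega) (by omega)]
    refine ⟨⟨hi, hf.1, by omega, rfl⟩, ?_⟩
    dsimp only
    rw [key i hi hf.1 hd, mem_rootOf_localInput]
    exact hf.2.imp (fun h => ⟨hi, h.symm⟩) id

theorem message_eq_ideal {v : V} {M : ℕ → ℕ → Finset (ℕ × ℕ)} {s : ℕ}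
    (hs : s < 3 * (I.params K).horizon)
    (hM : ∀ s' < s, ∀ p : Fin (I.net.deg v), M s' p = I.ideal K ω s' (I.net.nbr v p) v)
    (p : Fin (I.net.deg v)) :
    (I.localInput v).message (I.params K) ω M s p = I.ideal K ω s v (I.net.nbr v p) := by
  rcases lt_or_ge s (I.params K).horizon with h | h
  · exact message_down h hM p
  rcases lt_or_ge s (2 * (I.params K).horizon) with h' | h'
  · exact message_up h h' hM p
  · exact message_first h' hs hM p

end Instance

end Multicast

/-! ### Correctness of the run when no edge is overloaded -/

namespace Multicast

namespace Instance

variable {V : Type} [Fintype V] (I : Instance V) (K : ℕ) (ω : ℕ → Bool)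

/-- No edge is overloaded in any step. -/
def Good : Prop :=
  ∀ u w, ∀ t < (I.params K).horizon,
    ((I.edgeTrees u w).filter fun i => I.treeDelay K ω i = t).card ≤ (I.params K).load ∧
    ((I.edgeTrees u w).filter fun i => I.treeDelay K ω i + (I.tree i).level u = t).card ≤
      (I.params K).load

/-- The codebook for the messages from `u` to `w` or from `w` to `u`. -/
noncomputable def edgeCodebook (u w : V) (s : ℕ) : Finset (Finset (ℕ × ℕ)) :=
  (I.params K).codebook ω (I.edgeTrees u w) s

variable {I K ω}

theorem mem_candidates {i : ℕ} {u w : V} (hi : i ∈ I.ids) (hc : (I.tree i).IsChild u w)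
    {τ : ℕ} (hτ : I.treeDelay K ω i + (I.tree i).level u = τ) :
    i ∈ (I.params K).candidates ω (I.edgeTrees u w) τ := by
  rw [Params.candidates, Finset.mem_filter, mem_edgeTrees]
  have h1 : (I.tree i).depth ≤ I.dilation := Finset.le_sup (f := fun i => (I.tree i).depth) hi
  have h2 := hc.level_lt_depth
  have h3 : (I.params K).D = I.dilation := rfl
  unfold treeDelay at hτ
  exact ⟨⟨hi, hc.1⟩, by omega, by omega⟩

theorem rank_le_log {T : RootedTree I.net.graph} {u w : V} (h : T.IsChild u w) :
    T.rank w ≤ Nat.log 2 (Fintype.card V) :=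
  Nat.le_log_of_pow_le (by norm_num) h.two_pow_rank_le_card

/-- In every phase, delay plus level of the upper endpoint equals the clock, which is the second
count bounded in `Good`. In the second phase the upper endpoint is the receiver `w`. -/
theorem Good.ideal_mem_edgeCodebook (h : I.Good K ω) {s : ℕ}
    (hs : s < 3 * (I.params K).horizon) (u w : V) :
    I.ideal K ω s u w ∈ I.edgeCodebook K ω u w s := by
  classical
  have hn : (I.params K).n = Fintype.card V := rfl
  have hclock := (I.params K).clock_lt hs
  have hcard : ∀ (x y : V) (S : Finset ℕ) (f : ℕ → ℕ × ℕ),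
      (∀ i ∈ S, i ∈ I.edgeTrees x y ∧ I.treeDelay K ω i + (I.tree i).level x =
        (I.params K).clock s) → (S.image f).card ≤ (I.params K).load := by
    intro x y S f hS
    refine Finset.card_image_le.trans (le_trans (Finset.card_le_card ?_) (h x y _ hclock).2)
    intro i hi
    rw [Finset.mem_filter]
    exact hS i hi
  rw [edgeCodebook, Params.codebook, Finset.mem_filter, Finset.mem_powerset]
  rcases lt_or_ge s (I.params K).horizon with h1 | h1
  · have hτ : (I.params K).clock s = s := if_pos h1
    constructor
    · rintro ⟨i, r⟩ hir
      rw [mem_ideal_down h1] at hir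
      obtain ⟨hi, hc, hd, rfl⟩ := hir
      rw [Finset.mem_product, Finset.mem_range]
      exact ⟨mem_candidates hi hc (hd.trans hτ.symm), Nat.succ_pos _⟩
    · rw [ideal, if_pos h1]
      refine hcard u w _ _ fun i hi => ?_
      rw [Finset.mem_filter] at hi
      exact ⟨mem_edgeTrees.2 ⟨hi.1, hi.2.1.1⟩, hi.2.2.trans hτ.symm⟩
  rcases lt_or_ge s (2 * (I.params K).horizon) with h2 | h2
  · have hτ : (I.params K).clock s = 2 * (I.params K).horizon - 1 - s := by
      rw [Params.clock, if_neg h1.not_gt, if_pos h2]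
    constructor
    · rintro ⟨i, r⟩ hir
      rw [mem_ideal_up h1 h2] at hir
      obtain ⟨hi, hc, hd, rfl⟩ := hir
      rw [Finset.mem_product, Finset.mem_range, hn, edgeTrees_symm]
      exact ⟨mem_candidates hi hc (by omega), Nat.lt_succ_of_le (rank_le_log hc)⟩
    · rw [ideal, if_neg h1.not_gt, if_pos h2]
      refine hcard w u _ _ fun i hi => ?_
      rw [Finset.mem_filter] at hi
      exact ⟨mem_edgeTrees.2 ⟨hi.1, hi.2.1.1⟩, by omega⟩
  · have hτ : (I.params K).clock s = s - 2 * (I.params K).horizon := by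
      rw [Params.clock, if_neg (by omega), if_neg (by omega)]
    constructor
    · rintro ⟨i, r⟩ hir
      rw [mem_ideal_first h2] at hir
      obtain ⟨hi, hc, hd, rfl⟩ := hir
      rw [Finset.mem_product, Finset.mem_range]
      exact ⟨mem_candidates hi hc.1 (by omega), Nat.succ_pos _⟩
    · rw [ideal, if_neg (by omega), if_neg (by omega)]
      refine hcard u w _ _ fun i hi => ?_
      rw [Finset.mem_filter] at hi
      exact ⟨mem_edgeTrees.2 ⟨hi.1, hi.2.1.1.1⟩, by omega⟩

theorem Good.card_edgeCodebook_le (h : I.Good K ω) (hV : 2 ≤ Fintype.card V) {s : ℕ}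
    (hs : s < 3 * (I.params K).horizon) (u w : V) :
    (I.edgeCodebook K ω u w s).card ≤ 2 ^ ((I.params K).chunk * (I.params K).chunks) :=
  (I.params K).card_codebook_le hV (card_edgeTrees_le u w) (fun t ht => (h u w t ht).1) hs

section Run

variable {B : ℕ}

theorem input_run (t : ℕ) (v : V) :
    ((pathAlgorithm K).run B I ω t v : NodeState).input = I.localInput v := by
  induction t with
  | zero => rfl
  | succ t ih => exact ih

theorem bits_run (t : ℕ) (v : V) : ((pathAlgorithm K).run B I ω t v : NodeState).bits = ω := by
  induction t with
  | zero => rfl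
  | succ t ih => exact ih

theorem time_run (t : ℕ) (v : V) : ((pathAlgorithm K).run B I ω t v : NodeState).time = t := by
  induction t with
  | zero => rfl
  | succ t ih => exact congrArg Nat.succ ih

/-- The bit strings received so far encode the ideal messages. -/
def FollowsIdeal (K : ℕ) (ω : ℕ → Bool) (st : NodeState) (v : V) : Prop :=
  ∀ r < st.time, ∀ p : Fin (I.net.deg v), st.log r p =
    encode (I.edgeCodebook K ω v (I.net.nbr v p) (r / (I.params K).chunks)) (I.params K).chunk
      (I.params K).chunks (I.ideal K ω (r / (I.params K).chunks) (I.net.nbr v p) v)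
      (r % (I.params K).chunks)

theorem Good.received_eq (h : I.Good K ω) (hV : 2 ≤ Fintype.card V) {st : NodeState} {v : V}
    (hin : st.input = I.localInput v) (hbits : st.bits = ω)
    (hst : I.FollowsIdeal K ω st v) {s : ℕ} (hs : s < 3 * (I.params K).horizon)
    (hs' : (s + 1) * (I.params K).chunks ≤ st.time) (p : Fin (I.net.deg v)) :
    st.received K s p = I.ideal K ω s (I.net.nbr v p) v := by
  have hq := (I.params K).chunks_pos
  simp only [NodeState.received, hin, hbits, params_localInput, edgeTrees_localInput]
  rw [if_pos hs']
  refine decode_eq (h.card_edgeCodebook_le hV hs v _) ?_ fun r hr => ?_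
  · have := h.ideal_mem_edgeCodebook hs (I.net.nbr v p) v
    rwa [edgeCodebook, edgeTrees_symm] at this
  · have h1 : s * (I.params K).chunks + r < st.time := by
      rw [add_mul, one_mul] at hs'
      omega
    have h2 : (s * (I.params K).chunks + r) / (I.params K).chunks = s := by
      rw [mul_comm, Nat.mul_add_div hq, Nat.div_eq_of_lt hr, add_zero]
    have h3 : (s * (I.params K).chunks + r) % (I.params K).chunks = r := by
      rw [mul_comm, Nat.mul_add_mod, Nat.mod_eq_of_lt hr]
    rw [hst _ h1, h2, h3, edgeCodebook]

/-- While step `s` is running, all earlier steps are completely received, and `message` depends on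
no others. -/
theorem Good.send_eq (h : I.Good K ω) (hV : 2 ≤ Fintype.card V) {st : NodeState} {v : V}
    (hin : st.input = I.localInput v) (hbits : st.bits = ω)
    (hst : I.FollowsIdeal K ω st v)
    (ht : st.time < 3 * (I.params K).horizon * (I.params K).chunks) (p : Fin (I.net.deg v)) :
    st.send K p =
      encode (I.edgeCodebook K ω v (I.net.nbr v p) (st.time / (I.params K).chunks))
        (I.params K).chunk (I.params K).chunks
        (I.ideal K ω (st.time / (I.params K).chunks) v (I.net.nbr v p))
        (st.time % (I.params K).chunks) := by
  have hq := (I.params K).chunks_pos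
  have hs : st.time / (I.params K).chunks < 3 * (I.params K).horizon :=
    (Nat.div_lt_iff_lt_mul hq).2 ht
  have hmsg := message_eq_ideal (M := st.received K) hs (fun s' hs' p' =>
    h.received_eq hV hin hbits hst (hs'.trans hs) ((Nat.le_div_iff_mul_le hq).1 hs') p') p
  simp only [NodeState.send, hin, hbits, params_localInput, edgeTrees_localInput]
  rw [hmsg, edgeCodebook]

/-- Induction over the rounds for all nodes at once, since a string sent in a round depends only on
earlier ones. By `hB` the bandwidth limit cuts nothing off. -/
theorem Good.followsIdeal (h : I.Good K ω) (hV : 2 ≤ Fintype.card V)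
    (hB : (I.params K).chunk ≤ B) (t : ℕ)
    (ht : t ≤ 3 * (I.params K).horizon * (I.params K).chunks) (v : V) :
    I.FollowsIdeal K ω ((pathAlgorithm K).run B I ω t v) v := by
  induction t generalizing v with
  | zero =>
    intro r hr
    rw [time_run] at hr
    exact absurd hr (Nat.not_lt_zero r)
  | succ t ih =>
    intro r hr p
    rw [time_run] at hr
    have ih := ih (by omega)
    change Function.update ((pathAlgorithm K).run B I ω t v : NodeState).log
      ((pathAlgorithm K).run B I ω t v : NodeState).time _ r p = _
    rw [time_run]
    rcases Nat.lt_succ_iff_lt_or_eq.1 hr with hr | rfl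
    · rw [Function.update_of_ne hr.ne]
      exact ih v r (by rwa [time_run]) p
    · rw [Function.update_self, dif_pos p.2]
      have h1 := h.send_eq hV (input_run r (I.net.nbr v p)) (bits_run r _) (ih _)
        (by rw [time_run]; omega) (I.net.backPort v p)
      rw [time_run, Network.nbr_backPort] at h1
      change List.take B (NodeState.send _ K _) = _
      rw [Fin.eta, h1, List.take_of_length_le ((length_encode_le _ _ _ _ _).trans hB),
        edgeCodebook, edgeCodebook, edgeTrees_symm]

end Run

theorem one_le_congestion {i : ℕ} (hi : i ∈ I.ids) {u w : V}
    (h : (I.tree i).toSubgraph.Adj u w) : 1 ≤ I.congestion :=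
  (Finset.card_pos.2 ⟨i, mem_edgeTrees.2 ⟨hi, h⟩⟩).trans_le (card_edgeTrees_le u w)

theorem one_le_dilation {i : ℕ} (hi : i ∈ I.ids) {u w : V}
    (h : (I.tree i).toSubgraph.Adj u w) : 1 ≤ I.dilation := by
  have h1 : (I.tree i).depth ≤ I.dilation := Finset.le_sup (f := fun i => (I.tree i).depth) hi
  rcases RootedTree.isChild_or_isChild h with h2 | h2 <;>
  · have := h2.level_lt_depth
    omega

/-- A child recognises its parent as the sender of the token. For topmost edges, the lower endpoint
reads the mark it received and the upper endpoint recomputes the one it sent. -/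
theorem Good.describes (h : I.Good K ω) (hV : 2 ≤ Fintype.card V) {B : ℕ}
    (hB : (I.params K).chunk ≤ B) :
    I.Describes (fun i => (I.tree i).decomposition) ((pathAlgorithm K).result B I ω) := by
  intro i hi v p hadj
  -- A tree edge forces `C` and `D` to be positive, so this is not the case without rounds.
  have hrounds : (pathAlgorithm K).rounds (Fintype.card V) I.congestion I.dilation =
      3 * (I.params K).horizon * (I.params K).chunks := by
    change Params.rounds _ = _
    rw [Params.rounds, if_neg]
    · rfl
    · have h1 := one_le_congestion hi hadj
      have h2 := one_le_dilation hi hadj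
      dsimp only
      omega
  rw [Algorithm.result, hrounds]
  change ((NodeState.output _ K i p).toParent = true ↔ _) ∧
    ((NodeState.output _ K i p).first = true ↔ _)
  have hin := input_run (K := K) (B := B) (I := I) (ω := ω)
    (3 * (I.params K).horizon * (I.params K).chunks) v
  have hbits := bits_run (K := K) (B := B) (I := I) (ω := ω)
    (3 * (I.params K).horizon * (I.params K).chunks) v
  have htime := time_run (K := K) (B := B) (I := I) (ω := ω)
    (3 * (I.params K).horizon * (I.params K).chunks) v
  have hfol := h.followsIdeal hV hB _ le_rfl v
  have hrec : ∀ s < 3 * (I.params K).horizon, ∀ p' : Fin (I.net.deg v), _ = _ :=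
    fun s hs p' => h.received_eq hV hin hbits hfol hs
      (by rw [htime]; exact Nat.mul_le_mul_right _ hs) p'
  have hmsg : ∀ s < 3 * (I.params K).horizon, _ = _ := fun s hs =>
    message_eq_ideal (ω := ω) hs (fun s' hs' => hrec s' (hs'.trans hs)) p
  simp only [NodeState.output, hin, hbits, params_localInput, decide_eq_true_eq]
  constructor
  · constructor
    · rintro ⟨s, hs, hmem⟩
      rw [hrec s (by omega), mem_ideal_down hs] at hmem
      exact hmem.2.1
    · intro hc
      have h1 := treeDelay_add_level_lt (K := K) (ω := ω) hi hc
      refine ⟨_, Nat.lt_of_succ_lt h1, ?_⟩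
      rw [hrec _ (by omega), mem_ideal_down (by omega)]
      exact ⟨hi, hc, rfl, rfl⟩
  · have hprefix : (∃ q ∈ (I.tree i).decomposition,
        [I.net.nbr v p, v] <+: q ∨ [v, I.net.nbr v p] <+: q) ↔
        (I.tree i).First (I.net.nbr v p) v ∨ (I.tree i).First v (I.net.nbr v p) := by
      rw [← RootedTree.exists_pair_prefix_iff, ← RootedTree.exists_pair_prefix_iff, ← exists_or]
      simp only [and_or_left]
    rw [hprefix]
    constructor
    · rintro ⟨s, hs, hs', hmem⟩
      rw [hrec s hs', hmsg s hs', mem_ideal_first hs, mem_ideal_first hs] at hmem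
      exact hmem.imp (fun h => h.2.1) (fun h => h.2.1)
    · rintro (hf | hf) <;> have h1 := treeDelay_add_level_lt (K := K) (ω := ω) hi hf.1
      · refine ⟨I.treeDelay K ω i + (I.tree i).level (I.net.nbr v p) +
          2 * (I.params K).horizon, Nat.le_add_left _ _, by omega, .inl ?_⟩
        rw [hrec _ (by omega), mem_ideal_first (Nat.le_add_left _ _)]
        exact ⟨hi, hf, rfl, rfl⟩
      · refine ⟨I.treeDelay K ω i + (I.tree i).level v + 2 * (I.params K).horizon,
          Nat.le_add_left _ _, by omega, .inr ?_⟩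
        rw [hmsg _ (by omega), mem_ideal_first (Nat.le_add_left _ _)]
        exact ⟨hi, hf, rfl, rfl⟩

end Instance

end Multicast

/-! ### Estimates for the load and the number of rounds -/

namespace Multicast

open MeasureTheory
open scoped ENNReal Nat

theorem logb_two_le_two_mul {y : ℝ} (hy : 0 < y) : Real.logb 2 y ≤ 2 * y := by
  have h1 := Real.log_le_sub_one_of_pos hy
  have h2 := Real.log_two_gt_d9
  rw [Real.logb, div_le_iff₀ (by linarith)]
  nlinarith

/-- Squaring suffices, as `3 ^ 2 ≥ 2 ^ 3`; for the iterated logarithm below, `(3 / 2) ^ 2 ≥ 2`.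
These bounds keep denominators positive and absorb additive constants. -/
theorem three_halves_le_logb {n : ℕ} (hn : 3 ≤ n) : 3 / 2 ≤ Real.logb 2 n := by
  have hn' : (3 : ℝ) ≤ n := by exact_mod_cast hn
  have h1 : Real.logb 2 ((n : ℝ) ^ 2) = 2 * Real.logb 2 n := by
    rw [Real.logb_pow]
    norm_num
  have h2 : (3 : ℝ) ≤ Real.logb 2 ((n : ℝ) ^ 2) := by
    rw [Real.le_logb_iff_rpow_le (by norm_num) (by positivity)]
    norm_num
    nlinarith
  linarith

theorem half_le_logb_logb {n : ℕ} (hn : 3 ≤ n) : 1 / 2 ≤ Real.logb 2 (Real.logb 2 n) := by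
  have hL := three_halves_le_logb hn
  have h1 : Real.logb 2 (Real.logb 2 n ^ 2) = 2 * Real.logb 2 (Real.logb 2 n) := by
    rw [Real.logb_pow]
    norm_num
  have h2 : (1 : ℝ) ≤ Real.logb 2 (Real.logb 2 n ^ 2) := by
    rw [Real.le_logb_iff_rpow_le (by norm_num) (by positivity)]
    norm_num
    nlinarith
  linarith

/-- A single term of the exponential series gives `k ^ k / k! ≤ e ^ k`, and `e ≤ 3`. -/
theorem div_three_pow_le_factorial (k : ℕ) : ((k : ℝ) / 3) ^ k ≤ (k ! : ℕ) := by
  have h1 := Real.pow_div_factorial_le_exp (x := (k : ℝ)) (by positivity) k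
  have h2 : Real.exp k ≤ 3 ^ k := by
    have h3 := Real.exp_one_lt_d9
    calc Real.exp k = Real.exp 1 ^ k := by rw [← Real.exp_nat_mul, mul_one]
      _ ≤ 3 ^ k := pow_le_pow_left₀ (Real.exp_pos 1).le (by linarith) k
  have h4 : (0 : ℝ) < (k ! : ℕ) := by exact_mod_cast Nat.factorial_pos k
  rw [div_le_iff₀ h4] at h1
  rw [div_pow, div_le_iff₀ (by positivity), mul_comm]
  exact h1.trans (mul_le_mul_of_nonneg_right h2 h4.le)

namespace Params

variable (π : Params)

/-- Write `L = log₂ n` and `k` for the load. As `log₂ L ≤ 4 √L`, the summand 12 in `hK` gives `k / 3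
≥ √L`, so `k! ≥ √L ^ k`. The summand `2 * N` makes this at least `n ^ N`, since `k * log₂ L ≥ K *
L`. -/
theorem pow_le_factorial_load {N : ℕ} (hK : 2 * N + 12 ≤ π.K) (hn : 3 ≤ π.n) :
    π.n ^ N ≤ π.load ! := by
  have hK' : (2 * N + 12 : ℝ) ≤ π.K := by exact_mod_cast hK
  have hn' : (0 : ℝ) < π.n := by
    have : 0 < π.n := by omega
    exact_mod_cast this
  have hL := three_halves_le_logb hn
  have hLL := half_le_logb_logb hn
  have hk : (π.K : ℝ) * Real.logb 2 π.n / Real.logb 2 (Real.logb 2 π.n) ≤ π.load :=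
    Nat.le_ceil _
  set L := Real.logb 2 π.n with hLdef
  set LL := Real.logb 2 L with hLLdef
  set k := π.load
  rw [div_le_iff₀ (by linarith)] at hk
  have hs : 0 < √L := Real.sqrt_pos.2 (by linarith)
  have hsq : √L * √L = L := Real.mul_self_sqrt (by linarith)
  have h1 : LL ≤ 4 * √L := by
    have h2 := logb_two_le_two_mul hs
    have h3 : LL = 2 * Real.logb 2 √L := by
      rw [hLLdef, ← hsq, Real.logb_mul hs.ne' hs.ne', hsq]
      ring
    linarith
  have hk3 : √L ≤ (k : ℝ) / 3 := by
    have h2 : (12 : ℝ) * (√L * √L) ≤ k * (4 * √L) := by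
      rw [hsq]
      have h3 : (12 : ℝ) * L ≤ π.K * L := by
        apply mul_le_mul_of_nonneg_right _ (by linarith)
        have : (0 : ℝ) ≤ N := Nat.cast_nonneg N
        linarith
      exact h3.trans (hk.trans (mul_le_mul_of_nonneg_left h1 (Nat.cast_nonneg k)))
    have h4 : 12 * √L ≤ k * 4 := le_of_mul_le_mul_right (by linarith) hs
    linarith
  have hmain : (π.n : ℝ) ^ N ≤ √L ^ k := by
    rw [← Real.logb_le_logb (b := 2) (by norm_num) (by positivity) (by positivity),
      Real.logb_pow, Real.logb_pow, ← hLdef]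
    have h3 : LL = 2 * Real.logb 2 √L := by
      rw [hLLdef, ← hsq, Real.logb_mul hs.ne' hs.ne', hsq]
      ring
    have h5 : (2 * N : ℝ) * L ≤ π.K * L :=
      mul_le_mul_of_nonneg_right (by linarith) (by linarith)
    nlinarith
  have hfin := hmain.trans ((pow_le_pow_left₀ hs.le hk3 k).trans (div_three_pow_le_factorial k))
  exact_mod_cast hfin

theorem two_pow_delayBits_le : 2 ^ π.delayBits ≤ 2 * max π.C 1 := by
  rcases lt_or_ge 1 π.C with h | h
  · have h1 := Nat.pow_pred_clog_lt_self (b := 2) (by norm_num) h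
    have h2 : 0 < Nat.clog 2 π.C := Nat.clog_pos (by norm_num) h
    rw [delayBits, ← Nat.succ_pred_eq_of_pos h2, pow_succ]
    have := le_max_left π.C 1
    omega
  · rw [delayBits, Nat.clog_of_right_le_one h]
    have := le_max_right π.C 1
    omega

variable {π}

theorem load_le (hn : 3 ≤ π.n) : (π.load : ℝ) ≤
    (π.K + 2) * Real.logb 2 π.n / Real.logb 2 (Real.logb 2 π.n) := by
  have hL := three_halves_le_logb hn
  have hLL := half_le_logb_logb hn
  have h1 := logb_two_le_two_mul (y := Real.logb 2 π.n) (by linarith)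
  have h2 : 1 ≤ 2 * Real.logb 2 π.n / Real.logb 2 (Real.logb 2 π.n) := by
    rw [le_div_iff₀ (by linarith)]
    linarith
  have h3 : (π.load : ℝ) < _ + 1 := Nat.ceil_lt_add_one
    (a := (π.K : ℝ) * Real.logb 2 π.n / Real.logb 2 (Real.logb 2 π.n)) (by positivity)
  rw [add_mul, add_div]
  linarith

/-- Up to a factor 4, the number of items is at most `min C D * load * (log n + 1)`. The last two
factors have logarithms of order `log log n`, and constants are absorbed by `log log n ≥ 1 / 2`. -/
theorem width_le (hn : 3 ≤ π.n) (hC : 1 ≤ π.C) (hD : 1 ≤ π.D) (hload : 1 ≤ π.load) :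
    (π.width : ℝ) ≤ (12 + 2 * Real.logb 2 (π.K + 2)) * Real.logb 2 (Real.logb 2 π.n) +
      Real.logb 2 (min (π.C : ℝ) π.D) := by
  have hL := three_halves_le_logb hn
  have hLL := half_le_logb_logb hn
  have hk := load_le hn
  have ha : 0 ≤ Real.logb 2 (π.K + 2) :=
    Real.logb_nonneg (by norm_num) (by linarith [(Nat.cast_nonneg π.K : (0 : ℝ) ≤ π.K)])
  set X := min π.C ((π.D + 1) * π.load) * (Nat.log 2 π.n + 1) + 1 with hX
  have hμ : 1 ≤ min π.C π.D := le_min hC hD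
  have hX1 : 1 < X := by
    have : 1 ≤ min π.C ((π.D + 1) * π.load) := le_min hC (Nat.mul_pos (by omega) hload)
    have := Nat.mul_pos this (Nat.succ_pos (Nat.log 2 π.n))
    rw [Nat.succ_eq_add_one] at this
    omega
  have hX2 : X ≤ 4 * (min π.C π.D * (π.load * (Nat.log 2 π.n + 1))) := by
    have h1 : min π.C ((π.D + 1) * π.load) ≤ 2 * (min π.C π.D * π.load) := by
      rcases le_total π.C π.D with h | h
      · rw [min_eq_left h]
        refine (min_le_left _ _).trans ?_
        nlinarith
      · rw [min_eq_right h]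
        refine (min_le_right _ _).trans ?_
        nlinarith
    have h2 := Nat.mul_le_mul_right (Nat.log 2 π.n + 1) h1
    have h3 : 1 ≤ min π.C π.D * (π.load * (Nat.log 2 π.n + 1)) :=
      Nat.mul_pos hμ (Nat.mul_pos hload (Nat.succ_pos _))
    have h4 : 2 * (min π.C π.D * π.load) * (Nat.log 2 π.n + 1) =
      2 * (min π.C π.D * (π.load * (Nat.log 2 π.n + 1))) := by ring
    omega
  have hw : 2 ^ (π.width - 1) < X := Nat.pow_pred_clog_lt_self (by norm_num) hX1
  have hw' : (π.width : ℝ) - 1 ≤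
      Real.logb 2 (4 * (min (π.C : ℝ) π.D * (π.load * (Nat.log 2 π.n + 1)))) := by
    have h1 : (2 : ℝ) ^ (π.width - 1) ≤ 4 * (min (π.C : ℝ) π.D *
        (π.load * (Nat.log 2 π.n + 1))) := by exact_mod_cast hw.le.trans hX2
    have h2 : ((π.width - 1 : ℕ) : ℝ) ≤
        Real.logb 2 (4 * (min (π.C : ℝ) π.D * (π.load * (Nat.log 2 π.n + 1)))) := by
      rw [Real.le_logb_iff_rpow_le (by norm_num) (lt_of_lt_of_le (by positivity) h1),
        Real.rpow_natCast]
      exact h1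
    refine le_trans ?_ h2
    have : π.width ≤ (π.width - 1) + 1 := by omega
    have : (π.width : ℝ) ≤ ((π.width - 1 : ℕ) : ℝ) + 1 := by exact_mod_cast this
    linarith
  have hμ' : (0 : ℝ) < min (π.C : ℝ) π.D := by
    have : 0 < min π.C π.D := hμ
    exact_mod_cast this
  have hload' : (0 : ℝ) < π.load := by exact_mod_cast hload
  have hR : (0 : ℝ) < (Nat.log 2 π.n : ℝ) + 1 := by positivity
  rw [Real.logb_mul (by norm_num) (by positivity), Real.logb_mul hμ'.ne' (by positivity),
    Real.logb_mul hload'.ne' hR.ne', show (4 : ℝ) = 2 ^ 2 by norm_num, Real.logb_pow,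
    Real.logb_self_eq_one (by norm_num)] at hw'
  have h2 : ∀ y : ℝ, 0 < y → Real.logb 2 (2 * y) = 1 + Real.logb 2 y := fun y hy => by
    rw [Real.logb_mul (by norm_num) hy.ne', Real.logb_self_eq_one (by norm_num)]
  have hlogR : Real.logb 2 ((Nat.log 2 π.n : ℝ) + 1) ≤ 1 + Real.logb 2 (Real.logb 2 π.n) := by
    rw [← h2 _ (by linarith)]
    apply Real.logb_le_logb_of_le (by norm_num) hR
    have : (Nat.log 2 π.n : ℝ) ≤ Real.logb 2 π.n := Real.natLog_le_logb _ _
    linarith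
  have hlogk : Real.logb 2 π.load ≤
      1 + Real.logb 2 (π.K + 2) + Real.logb 2 (Real.logb 2 π.n) := by
    rw [add_assoc, ← Real.logb_mul (by positivity) (by positivity), ← h2 _ (by positivity)]
    apply Real.logb_le_logb_of_le (by norm_num) hload'
    refine hk.trans ?_
    rw [div_le_iff₀ (by linarith)]
    have h3 : 0 ≤ (π.K + 2) * Real.logb 2 π.n := by positivity
    nlinarith
  have h4 : Real.logb 2 (π.K + 2) ≤
      2 * Real.logb 2 (π.K + 2) * Real.logb 2 (Real.logb 2 π.n) := by nlinarith
  push_cast at hw'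
  nlinarith

/-- The factor `log n` in the load cancels against `chunk ≥ log n / 2`, and the remaining
denominator `log log n` divides the width. -/
theorem chunks_le (hn : 3 ≤ π.n) (hC : 1 ≤ π.C) (hD : 1 ≤ π.D) (hload : 1 ≤ π.load) :
    (π.chunks : ℝ) ≤ (1 + 2 * (π.K + 2) * (12 + 2 * Real.logb 2 (π.K + 2))) *
      (1 + Real.logb 2 (min (π.C : ℝ) π.D) / Real.logb 2 (Real.logb 2 π.n)) := by
  have hL := three_halves_le_logb hn
  have hLL := half_le_logb_logb hn
  have hk := load_le hn
  have hw := width_le hn hC hD hload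
  have ha : 0 ≤ Real.logb 2 (π.K + 2) :=
    Real.logb_nonneg (by norm_num) (by linarith [(Nat.cast_nonneg π.K : (0 : ℝ) ≤ π.K)])
  have hμ : 0 ≤ Real.logb 2 (min (π.C : ℝ) π.D) := by
    apply Real.logb_nonneg (by norm_num)
    have : 1 ≤ min π.C π.D := le_min hC hD
    exact_mod_cast this
  have hchunk : Real.logb 2 π.n / 2 ≤ π.chunk := by
    have h1 : 1 ≤ π.chunk := Nat.log_pos (by norm_num) (by omega)
    have h2 : (1 : ℝ) ≤ π.chunk := by exact_mod_cast h1
    have h3 : Real.logb 2 π.n ≤ π.chunk + 1 := by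
      rw [Real.logb_le_iff_le_rpow (by norm_num) (by
        have : 0 < π.n := by omega
        exact_mod_cast this)]
      have := (Nat.lt_pow_succ_log_self (b := 2) (by norm_num) π.n).le
      exact_mod_cast this
    linarith
  set L := Real.logb 2 π.n
  set LL := Real.logb 2 L
  set a := Real.logb 2 (π.K + 2)
  set l := Real.logb 2 (min (π.C : ℝ) π.D)
  have hc0 : (0 : ℝ) < π.chunk := by linarith
  have h1 : (π.chunks : ℝ) ≤ π.load * π.width / π.chunk + 1 := by
    rw [chunks]
    push_cast
    have := Nat.cast_div_le (α := ℝ) (m := π.load * π.width) (n := π.chunk)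
    push_cast at this
    linarith
  have h2 : (π.load * π.width / π.chunk : ℝ) ≤
      ((π.K + 2) * L / LL) * ((12 + 2 * a) * LL + l) / (L / 2) := by
    gcongr
  have h3 : ((π.K + 2) * L / LL) * ((12 + 2 * a) * LL + l) / (L / 2) =
      2 * (π.K + 2) * ((12 + 2 * a) + l / LL) := by
    have hL0 : L ≠ 0 := by linarith
    have hLL0 : LL ≠ 0 := by linarith
    field_simp
  have hl : 0 ≤ l / LL := div_nonneg hμ (by linarith)
  have hK : (0 : ℝ) ≤ π.K := Nat.cast_nonneg _
  have h4 : 2 * ((π.K : ℝ) + 2) * (l / LL) ≤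
      2 * ((π.K : ℝ) + 2) * (12 + 2 * a) * (l / LL) := by
    apply mul_le_mul_of_nonneg_right _ hl
    nlinarith
  rw [h3] at h2
  calc (π.chunks : ℝ) ≤ 2 * (π.K + 2) * ((12 + 2 * a) + l / LL) + 1 := by linarith
    _ ≤ _ := by linarith

theorem one_le_load (hK : 1 ≤ π.K) (hn : 3 ≤ π.n) : 1 ≤ π.load := by
  have hL := three_halves_le_logb hn
  have hLL := half_le_logb_logb hn
  have hK' : (0 : ℝ) < π.K := by exact_mod_cast hK
  exact Nat.ceil_pos.2 (div_pos (mul_pos hK' (by linarith)) (by linarith))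

theorem rounds_le (hK : 1 ≤ π.K) (hn : 3 ≤ π.n) :
    (π.rounds : ℝ) ≤ 6 * (1 + 2 * (π.K + 2) * (12 + 2 * Real.logb 2 (π.K + 2))) *
      (((π.C : ℝ) + π.D) *
        (1 + Real.logb 2 (min (π.C : ℝ) π.D) / Real.logb 2 (Real.logb 2 π.n))) := by
  have hLL := half_le_logb_logb hn
  have ha : 0 ≤ Real.logb 2 (π.K + 2) :=
    Real.logb_nonneg (by norm_num) (by linarith [(Nat.cast_nonneg π.K : (0 : ℝ) ≤ π.K)])
  rw [rounds]
  split_ifs with h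
  · have h0 : min (π.C : ℝ) π.D = 0 := by
      rcases h with h | h <;> simp [h]
    -- Since `Real.logb 2 0 = 0`, the claimed bound is nonnegative when `C` or `D` vanishes.
    rw [h0, Real.logb_zero, zero_div, Nat.cast_zero]
    positivity
  · push Not at h
    have hC := Nat.one_le_iff_ne_zero.2 h.1
    have hD := Nat.one_le_iff_ne_zero.2 h.2
    have h1 := chunks_le hn hC hD (one_le_load hK hn)
    have h2 : (π.horizon : ℝ) ≤ 2 * ((π.C : ℝ) + π.D) := by
      have := π.two_pow_delayBits_le
      rw [max_eq_left hC] at this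
      have h3 : π.horizon ≤ 2 * (π.C + π.D) := by
        rw [horizon]
        omega
      exact_mod_cast h3
    push_cast
    have h3 : (π.horizon : ℝ) * π.chunks ≤ _ :=
      mul_le_mul h2 h1 (Nat.cast_nonneg _) (by positivity)
    linarith

end Params

/-! ### The failure probability -/

namespace Instance

variable {V : Type} [Fintype V] (I : Instance V)

theorem dilation_le : I.dilation ≤ Fintype.card V :=
  Finset.sup_le fun i _ => Finset.sup_le fun v _ => ((I.tree i).level_lt_card v).le

theorem horizon_le (K : ℕ) {b : ℕ} (hV : 1 ≤ Fintype.card V)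
    (hC : I.congestion ≤ Fintype.card V ^ b) :
    (I.params K).horizon ≤ 3 * Fintype.card V ^ (b + 1) := by
  have h1 := (I.params K).two_pow_delayBits_le
  have h2 : max (I.params K).C 1 ≤ Fintype.card V ^ b := max_le hC (Nat.one_le_pow _ _ hV)
  have h3 : Fintype.card V ^ b ≤ Fintype.card V ^ (b + 1) := Nat.pow_le_pow_right hV (by omega)
  have h4 : Fintype.card V ^ 1 ≤ Fintype.card V ^ (b + 1) := Nat.pow_le_pow_right hV (by omega)
  rw [pow_one] at h4
  have h5 := I.dilation_le
  have h6 : (I.params K).horizon = 2 ^ (I.params K).delayBits + I.dilation := rfl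
  omega

/-- A union bound over ordered pairs of vertices, times and the two kinds of overload. Equal delays
correspond to shift zero, simultaneous use of the edge to a shift by the level. -/
theorem fairBits_not_good_le (K : ℕ) :
    fairBits {ω | ¬ I.Good K ω} ≤
      ((2 * Fintype.card V ^ 2 * (I.params K).horizon : ℕ) : ℝ≥0∞) *
        (((I.params K).load ! : ℕ) : ℝ≥0∞)⁻¹ := by
  let bad (u w : V) (sh : ℕ → ℕ) (t : ℕ) : Set (ℕ → Bool) :=
    {ω | (I.params K).load ≤ ((I.edgeTrees u w).filter fun i =>
      delay (I.params K).delayBits ω i + sh i = t).card}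
  have hbad : ∀ u w sh t, fairBits (bad u w sh t) ≤ (((I.params K).load ! : ℕ) : ℝ≥0∞)⁻¹ :=
    fun u w sh t => fairBits_load_le
      ((card_edgeTrees_le u w).trans (Nat.le_pow_clog (by norm_num) _)) _ _ _
  have hsub : {ω | ¬ I.Good K ω} ⊆ ⋃ x ∈ (Finset.univ : Finset (V × V)) ×ˢ
      Finset.range (I.params K).horizon,
      (bad x.1.1 x.1.2 (fun _ => 0) x.2 ∪
        bad x.1.1 x.1.2 (fun i => (I.tree i).level x.1.1) x.2) := by
    intro ω hω
    by_contra hcon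
    refine hω fun u w t ht => ?_
    rw [Set.mem_iUnion₂] at hcon
    push Not at hcon
    have h := hcon ((u, w), t) (by simpa using ht)
    rw [Set.mem_union, not_or] at h
    exact ⟨(not_le.1 h.1).le, (not_le.1 h.2).le⟩
  refine (measure_mono hsub).trans ((measure_biUnion_finset_le _ _).trans ?_)
  refine (Finset.sum_le_card_nsmul _ _ (2 * (((I.params K).load ! : ℕ) : ℝ≥0∞)⁻¹)
    fun x _ => ?_).trans (le_of_eq ?_)
  · rw [two_mul]
    exact (measure_union_le _ _).trans (add_le_add (hbad _ _ _ _) (hbad _ _ _ _))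
  · rw [Finset.card_product, Finset.card_univ, Fintype.card_prod, Finset.card_range,
      nsmul_eq_mul]
    push_cast
    ring

/-- The exponent `b + c + 5` pays for `n ^ 2` pairs, a horizon of order `n ^ (b + 1)`, the target `n
^ c`, and the constant `6 ≤ n ^ 2`. -/
theorem fairBits_not_good_le_inv_pow {K b c : ℕ} (hK : 2 * (b + c + 5) + 12 ≤ K)
    (hV : 3 ≤ Fintype.card V) (hC : I.congestion ≤ Fintype.card V ^ b) :
    fairBits {ω | ¬ I.Good K ω} ≤ ENNReal.ofReal (1 / (Fintype.card V : ℝ) ^ c) := by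
  have hn : (0 : ℝ) < Fintype.card V := by
    have : 0 < Fintype.card V := by omega
    exact_mod_cast this
  refine (I.fairBits_not_good_le K).trans ?_
  have h1 : Fintype.card V ^ (b + c + 5) ≤ (I.params K).load ! :=
    (I.params K).pow_le_factorial_load hK hV
  have h2 := I.horizon_le K (by omega) hC
  have h3 : 2 * Fintype.card V ^ 2 * (I.params K).horizon * Fintype.card V ^ c ≤
      (I.params K).load ! := by
    calc 2 * Fintype.card V ^ 2 * (I.params K).horizon * Fintype.card V ^ c
        ≤ 2 * Fintype.card V ^ 2 * (3 * Fintype.card V ^ (b + 1)) * Fintype.card V ^ c := by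
          gcongr
      _ = 6 * Fintype.card V ^ (b + c + 3) := by ring
      _ ≤ Fintype.card V ^ 2 * Fintype.card V ^ (b + c + 3) := by
          gcongr
          nlinarith
      _ = Fintype.card V ^ (b + c + 5) := by ring
      _ ≤ _ := h1
  have h4 : ((I.params K).load ! : ℝ≥0∞) ≠ 0 := by
    exact_mod_cast (Nat.factorial_pos _).ne'
  rw [one_div, ENNReal.ofReal_inv_of_pos (by positivity), ENNReal.ofReal_pow hn.le,
    ENNReal.ofReal_natCast, ← div_eq_mul_inv, ENNReal.div_le_iff h4 (by simp),
    mul_comm (_ ^ c)⁻¹,    ← div_eq_mul_inv, ENNReal.le_div_iff_mul_le (.inl (by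
      rw [← Nat.cast_pow]
      exact_mod_cast (pow_pos (by omega : 0 < Fintype.card V) c).ne')) (.inl (by simp))]
  exact_mod_cast h3

end Instance

end Multicast

/-! ### The main theorem -/

theorem mainTheorem6 (ε : ℝ) (hε : 0 ≤ ε) (β : ℕ) (hβ : 1 ≤ β) (b c : ℕ) :
    ∃ (A : ℝ) (alg : Multicast.Algorithm),
      (∀ n C D : ℕ, 3 ≤ n →
        (alg.rounds n C D : ℝ) ≤
          A * (((C : ℝ) + D) *
            (1 + Real.logb 2 (min (C : ℝ) D) / Real.logb 2 (Real.logb 2 n)))) ∧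
      ∀ (V : Type) [Fintype V] (I : Multicast.Instance V),
        3 ≤ Fintype.card V → I.congestion ≤ Fintype.card V ^ b →
        Multicast.fairBits
          {ω | ¬ I.IsShortDecomposition
            (Real.logb 2 (Fintype.card V) ^ (1 + ε)) (Real.logb 2 (Fintype.card V))
            (alg.result (β * Nat.log 2 (Fintype.card V)) I ω)} ≤
          ENNReal.ofReal (1 / (Fintype.card V : ℝ) ^ c) := by
  refine ⟨6 * (1 + 2 * (((2 * (b + c + 5) + 12 : ℕ) : ℝ) + 2) *
      (12 + 2 * Real.logb 2 (((2 * (b + c + 5) + 12 : ℕ) : ℝ) + 2))),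
    Multicast.pathAlgorithm (2 * (b + c + 5) + 12),
    fun n C D hn => Multicast.Params.rounds_le (π := ⟨2 * (b + c + 5) + 12, n, C, D⟩)
      (by simp) hn, ?_⟩
  intro V _ I hV hC
  refine le_trans (MeasureTheory.measure_mono ?_)
    (I.fairBits_not_good_le_inv_pow (K := 2 * (b + c + 5) + 12) (c := c) le_rfl hV hC)
  intro ω hω hgood
  refine hω ⟨fun i => (I.tree i).decomposition, fun i _ =>
    ⟨(I.tree i).isPathDecomposition_decomposition, (I.tree i).isShort_decomposition ?_ le_rfl⟩,
    hgood.describes (by omega) (Nat.le_mul_of_pos_left _ hβ)⟩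
  -- Only the sign of `ℓ` matters, because the `log₂ n` term alone bounds the number of paths.
  have := Multicast.three_halves_le_logb hV
  positivity
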